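/- Let $K\ge 1$ be the number of classes, let $n_1,\dots,n_K\ge 1$ be the class sizes, $N=\sum_k n_k$, and let $\lambda_Z,\lambda_b>0$. Index the columns of $K\times N$ matrices by pairs $(k,i)$ with $1\le k\le K$, $1\le i\le n_k$, and let $Y\in\mathbb{R}^{K\times N}$ be the matrix whose column $(k,i)$ is the standard basis vector $e_k$. Put $D=YY^\top=\mathrm{diag}(n_1,\dots,n_K)$ and $\ell_{CE}(z,e_k)=\log\sum_{l=1}^K e^{z_l}-z_k$. Consider $$\mathcal L(Z,b)=\frac1N\sum_{k=1}^K\sum_{i=1}^{n_k}\ell_{CE}(z_{ki}+b,e_k)+\lambda_Z\|Z\|_*+\frac{\lambda_b}{2}\|b\|^2,\qquad Z=[z_{ki}]\in\mathbb{R}^{K\times N},\ b\in\mathbb{R}^K,$$ where $\|\cdot\|_*$ is the nuclear norm. Let $N_1,\dots,N_J$ be the distinct values of $n_1,\dots,n_K$, let $\Gamma_j=\{k: n_k=N_j\}$ be the clusters, $1_{\Gamma_j}\in\mathbb{R}^K$ their indicator vectors and $I_{\Gamma_j}=\mathrm{diag}(1_{\Gamma_j})$. Say that a $K\times K$ matrix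 has block structure if it is of the form $\sum_j a_j I_{\Gamma_j}+\sum_{j,j'}a_{jj'}1_{\Gamma_j}1_{\Gamma_{j'}}^\top$ with real $a_j,a_{jj'}$. Then $\mathcal L$ has a unique global minimizer $(Z,b)$. With $\bar z_k=\frac1{n_k}\sum_i z_{ki}$ and $\bar Z=[\bar z_1,\dots,\bar z_K]$ it has the following properties. (a) $z_{ki}=\bar z_k$ for all $k,i$, that is, $Z=\bar ZY$; and $\langle\bar z_k,\mathbf 1_K\rangle=0$ for all $k$. (b) There are reals $a_j,a_{jj'},c_j$ with $$\bar Z=\sum_{j}a_jI_{\Gamma_j}+\sum_{j,j'}a_{jj'}1_{\Gamma_j}1_{\Gamma_{j'}}^\top,\qquad b=\sum_jc_j1_{\Gamma_j},\qquad a_j+\sum_{j'}a_{j'j}|\Gamma_{j'}|=0\ \text{ for all } j.$$ In particular, within each cluster all pairs of distinct classes have the same angle between their mean prediction vectors $\bar z_k$. (c) If $n_1=\dots=n_K=N/K$, then $b=0$ and $\bar Z=a(KI_K-J_K)$ with $J_K$ the all-ones matrix, where $a=0$ if $N\lambda_Z\ge\sqrt{N/K}$, and $a=\frac1K\log\Big(\frac{\sqrt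 K}{\sqrt N\lambda_Z}-K+1\Big)$ if $N\lambda_Z<\sqrt{N/K}$. (d) Let $\bar ZD^{1/2}=\bar U\bar\Sigma\bar V^\top$ be any singular value decomposition ($\bar U,\bar V$ orthogonal $K\times K$ matrices, $\bar\Sigma$ diagonal with nonnegative entries) and put $$W=\bar\Sigma^{1/2}\bar U^\top,\qquad \bar H=\bar\Sigma^{1/2}\bar V^\top D^{-1/2},\qquad H=\bar HY.$$ Then $\bar Z=W^\top\bar H$ and $Z=W^\top H$. The matrices $W^\top W$ and $\bar H^\top\bar H$ have block structure, and within each cluster all pairs of distinct columns of $\bar H$ have the same angle. Moreover, for all $\lambda_W,\lambda_H>0$ with $\sqrt{\lambda_W\lambda_H}=\lambda_Z$ and all $d\ge K$, the global minimizers $(W',H',b')\in\mathbb{R}^{d\times K}\times\mathbb{R}^{d\times N}\times\mathbb{R}^K$ of $$\frac1N\sum_{k,i}\ell_{CE}(W'^\top h'_{ki}+b',e_k)+\frac{\lambda_W}2\|W'\|_F^2+\frac{\lambda_H}2\|H'\|_F^2+\frac{\lambda_b}2\|b'\|^2$$ are exactly the triples with $b'=b$, $W'=(\lambda_H/\lambda_W)^{1/4}QW$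 and $H'=(\lambda_W/\lambda_H)^{1/4}QH$, where $Q\in\mathbb{R}^{d\times K}$ satisfies $Q^\top Q=I_K$. (The angle of a pair of vectors one of which is zero is taken to be $\pi/2$.) -/

import Mathlib

namespace UFM

open Matrix

noncomputable section

/-- Index set of the `N = ∑ k, n k` samples: the pair `⟨k, i⟩` is the `i`-th sample of class `k`. -/
abbrev Sample {K : ℕ} (n : Fin K → ℕ) : Type := (k : Fin K) × Fin (n k)

/-- The total number `N` of samples, as a real number. -/
def total {K : ℕ} (n : Fin K → ℕ) : ℝ := ∑ k, (n k : ℝ)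

/-- The label matrix `Y`, whose column `⟨k, i⟩` is the one-hot vector `e_k`. -/
def labels {K : ℕ} (n : Fin K → ℕ) : Matrix (Fin K) (Sample n) ℝ :=
  Matrix.of fun l s => if l = s.1 then 1 else 0

/-- The cross-entropy loss of the prediction vector `z` for the label `k`. -/
def crossEntropy {K : ℕ} (z : Fin K → ℝ) (k : Fin K) : ℝ :=
  Real.log (∑ l, Real.exp (z l)) - z k

/-- The nuclear norm: the sum of the singular values. -/
def nuclearNorm {ι κ : Type*} [Fintype ι] [Fintype κ] [DecidableEq κ]
    (A : Matrix ι κ ℝ) : ℝ :=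
  (Matrix.toEuclideanLin A).singularValues.sum fun _ s => s

/-- The squared Frobenius norm. -/
def frobSq {ι κ : Type*} [Fintype ι] [Fintype κ] (A : Matrix ι κ ℝ) : ℝ :=
  ∑ i, ∑ j, A i j ^ 2

/-- The average cross-entropy loss of the predictions `Z + b 1ᵀ`. -/
def avgLoss {K : ℕ} (n : Fin K → ℕ) (Z : Matrix (Fin K) (Sample n) ℝ) (b : Fin K → ℝ) : ℝ :=
  (1 / total n) * ∑ k, ∑ i : Fin (n k), crossEntropy (fun l => Z l ⟨k, i⟩ + b l) k

/-- The convexified objective `L(Z, b)`. -/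
def convexObjective {K : ℕ} (n : Fin K → ℕ) (lamZ lamb : ℝ)
    (p : Matrix (Fin K) (Sample n) ℝ × (Fin K → ℝ)) : ℝ :=
  avgLoss n p.1 p.2 + lamZ * nuclearNorm p.1 + lamb / 2 * ∑ k, p.2 k ^ 2

/-- The factorized objective `L(W, H, b)` with feature dimension `d`. -/
def factorizedObjective {K : ℕ} (n : Fin K → ℕ) (lamW lamH lamb : ℝ) (d : ℕ)
    (p : Matrix (Fin d) (Fin K) ℝ × Matrix (Fin d) (Sample n) ℝ × (Fin K → ℝ)) : ℝ :=
  avgLoss n (p.1ᵀ * p.2.1) p.2.2 + lamW / 2 * frobSq p.1 + lamH / 2 * frobSq p.2.1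
    + lamb / 2 * ∑ k, p.2.2 k ^ 2

/-- The matrix `Z̄` whose `k`-th column is the sample mean of the columns of `Z` in class `k`. -/
def classMean {K : ℕ} (n : Fin K → ℕ) (Z : Matrix (Fin K) (Sample n) ℝ) :
    Matrix (Fin K) (Fin K) ℝ :=
  Matrix.of fun l k => (1 / (n k : ℝ)) * ∑ i : Fin (n k), Z l ⟨k, i⟩

/-- The cluster of all classes with exactly `m` samples. -/
def cluster {K : ℕ} (n : Fin K → ℕ) (m : ℕ) : Finset (Fin K) :=
  Finset.univ.filter fun k => n k = m

/-- The indicator vector of a set of classes. -/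
def indVec {K : ℕ} (s : Finset (Fin K)) : Fin K → ℝ := fun k => if k ∈ s then 1 else 0

/-- `blockMatrix n Ns a A = ∑ⱼ aⱼ I_{Γⱼ} + ∑_{j,j'} A_{jj'} 1_{Γⱼ} 1_{Γⱼ'}ᵀ`, where `Γⱼ` is the
cluster of the classes with `Ns j` samples. -/
def blockMatrix {K J : ℕ} (n : Fin K → ℕ) (Ns : Fin J → ℕ) (a : Fin J → ℝ)
    (A : Fin J → Fin J → ℝ) : Matrix (Fin K) (Fin K) ℝ :=
  ∑ j, a j • Matrix.diagonal (indVec (cluster n (Ns j)))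
    + ∑ j, ∑ j', A j j' • Matrix.vecMulVec (indVec (cluster n (Ns j))) (indVec (cluster n (Ns j')))

/-- Column `k` of a matrix as a vector of Euclidean space. -/
def colVec {ι κ : Type*} (M : Matrix ι κ ℝ) (k : κ) : EuclideanSpace ℝ ι :=
  WithLp.toLp 2 fun i => M i k

/-- Any two distinct columns of `M` that belong to the same cluster form the same angle, which
depends on the cluster only. -/
def EqualAngles {K : ℕ} {ι : Type*} [Fintype ι] (n : Fin K → ℕ) (M : Matrix ι (Fin K) ℝ) : Prop :=
  ∀ m : ℕ, ∀ k ∈ cluster n m, ∀ l ∈ cluster n m, ∀ k' ∈ cluster n m, ∀ l' ∈ cluster n m,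
    k ≠ l → k' ≠ l' →
    InnerProductGeometry.angle (colVec M k) (colVec M l) =
      InnerProductGeometry.angle (colVec M k') (colVec M l')

end

end UFM

namespace UFM

open Matrix

/-! ### The variational formula for the nuclear norm. -/

section NuclearNorm

variable {ι κ μ : Type*} [Fintype ι] [Fintype κ] [Fintype μ]

/-! Everything rests on the formula ‖A‖_* = min (‖W‖² + ‖H‖²)/2 over factorizations A = WᵀH
(`nuclearNorm_le`, `exists_factorization`). Its lower bound is a duality estimate with explicit
slack, `two_mul_trace_add_defects`: for partial isometries U, V the gap in 2 tr(Uᵀ WᵀH V) ≤ ‖W‖² +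
‖H‖² is a sum of three squared Frobenius norms. Convexity and permutation invariance of the nuclear
norm, existence of a minimizer and the classification of optimal factorizations all come from this
formula.

Uniqueness (`eq_of_isMinOn`): the ridge term is strictly convex in b, and the cross-entropy is
strictly convex except along constant vectors. Two minimizers therefore share b and have columns
differing by constants; these vanish because a minimizer has centered columns
(`sum_eq_zero_of_isMinOn`).

Uniqueness turns every symmetry of the objective into a symmetry of the minimizer
(`perm_of_isMinOn`). Exchanging samples of one class gives within-class collapse; relabeling classes
of equal size makes Z̄ and b invariant, which is block structure. With equal class sizes and K > 1
only one scalar is left, and `scalar_minimizer` finds it.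

For the factors, WᵀW is the positive square root of MMᵀ with M = Z̄D^{1/2}, so it inherits the
invariance of M; transposing M treats H̄. A minimizer of the factorized model makes all three
defects vanish, which determines it up to an isometry (`exists_isometry_of_optimal_factorization`).
-/

theorem frobSq_eq_trace (A : Matrix ι κ ℝ) : frobSq A = (Aᵀ * A).trace := by
  simp only [frobSq, trace, diag, mul_apply, transpose_apply]
  rw [Finset.sum_comm]
  simp only [sq]

theorem frobSq_nonneg (A : Matrix ι κ ℝ) : 0 ≤ frobSq A :=
  Finset.sum_nonneg fun _ _ => Finset.sum_nonneg fun _ _ => sq_nonneg _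

theorem frobSq_eq_zero {A : Matrix ι κ ℝ} (h : frobSq A = 0) : A = 0 := by
  ext i j
  have h1 := (Finset.sum_eq_zero_iff_of_nonneg
    (fun i _ => Finset.sum_nonneg fun j _ => sq_nonneg (A i j))).1 h i (Finset.mem_univ _)
  have h2 := (Finset.sum_eq_zero_iff_of_nonneg
    (fun j _ => sq_nonneg (A i j))).1 h1 j (Finset.mem_univ _)
  simpa using h2

theorem frobSq_smul (c : ℝ) (A : Matrix ι κ ℝ) : frobSq (c • A) = c ^ 2 * frobSq A := by
  simp [frobSq, mul_pow, Finset.mul_sum]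

theorem frobSq_fromRows (A : Matrix ι κ ℝ) (B : Matrix μ κ ℝ) :
    frobSq (fromRows A B) = frobSq A + frobSq B := by
  simp only [frobSq, Fintype.sum_sum_type, fromRows_apply_inl, fromRows_apply_inr]

theorem frobSq_submatrix (A : Matrix ι κ ℝ) (e : κ ≃ κ) :
    frobSq (A.submatrix id e) = frobSq A := by
  simp only [frobSq, submatrix_apply, id]
  exact Finset.sum_congr rfl fun i _ => Equiv.sum_comp e fun j => A i j ^ 2

theorem frobSq_isometry_mul [DecidableEq ι] {Q : Matrix μ ι ℝ} (hQ : Qᵀ * Q = 1)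
    (A : Matrix ι κ ℝ) : frobSq (Q * A) = frobSq A := by
  rw [frobSq_eq_trace, frobSq_eq_trace, transpose_mul, Matrix.mul_assoc, ← Matrix.mul_assoc Qᵀ,
    hQ, Matrix.one_mul]

/-- Pythagoras for the projection `U Uᵀ` of a partial isometry `U`. -/
theorem frobSq_mul_partialIsometry {U : Matrix κ μ ℝ} (hU : U * Uᵀ * U = U) (W : Matrix ι κ ℝ) :
    frobSq (W * U) + frobSq (W - W * U * Uᵀ) = frobSq W := by
  have e : ∀ X : Matrix κ κ ℝ, (Wᵀ * W * X).trace = (X * (Wᵀ * W)).trace :=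
    fun X => trace_mul_comm _ _
  have h1 : frobSq (W * U) = (U * Uᵀ * (Wᵀ * W)).trace := by
    rw [frobSq_eq_trace, transpose_mul, Matrix.mul_assoc, trace_mul_comm, Matrix.mul_assoc,
      Matrix.mul_assoc, ← Matrix.mul_assoc Wᵀ, e]
  have h2 : U * Uᵀ * (U * Uᵀ) = U * Uᵀ := by rw [← Matrix.mul_assoc, hU]
  have h3 : (W - W * U * Uᵀ)ᵀ * (W - W * U * Uᵀ)
      = Wᵀ * W - Wᵀ * W * (U * Uᵀ) - U * Uᵀ * (Wᵀ * W) + U * Uᵀ * (Wᵀ * W) * (U * Uᵀ) := by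
    simp only [transpose_sub, transpose_mul, transpose_transpose, Matrix.sub_mul, Matrix.mul_sub,
      Matrix.mul_assoc]
    abel
  rw [h1, frobSq_eq_trace (W - _), frobSq_eq_trace W, h3, trace_add, trace_sub, trace_sub, e,
    trace_mul_comm (U * Uᵀ * (Wᵀ * W)), ← Matrix.mul_assoc (U * Uᵀ) (U * Uᵀ), h2]
  ring

theorem two_mul_trace_transpose_mul (X Y : Matrix ι κ ℝ) :
    2 * (Xᵀ * Y).trace + frobSq (X - Y) = frobSq X + frobSq Y := by
  have h : (Yᵀ * X).trace = (Xᵀ * Y).trace := by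
    rw [← trace_transpose, transpose_mul, transpose_transpose]
  simp only [frobSq_eq_trace, transpose_sub, Matrix.sub_mul, Matrix.mul_sub, trace_sub, h]
  ring

/-- The defect in the duality bound for `⟨U Vᵀ, Wᵀ H⟩`. -/
theorem two_mul_trace_add_defects {ν : Type*} [Fintype ν] {U : Matrix ι ν ℝ} {V : Matrix κ ν ℝ}
    (hU : U * Uᵀ * U = U) (hV : V * Vᵀ * V = V) (W : Matrix μ ι ℝ) (H : Matrix μ κ ℝ) :
    2 * (Uᵀ * (Wᵀ * H) * V).trace + frobSq (W * U - H * V) + frobSq (W - W * U * Uᵀ)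
      + frobSq (H - H * V * Vᵀ) = frobSq W + frobSq H := by
  have h := two_mul_trace_transpose_mul (W * U) (H * V)
  rw [← frobSq_mul_partialIsometry hU W, ← frobSq_mul_partialIsometry hV H]
  have : Uᵀ * (Wᵀ * H) * V = (W * U)ᵀ * (H * V) := by
    simp only [transpose_mul, Matrix.mul_assoc]
  rw [this]
  linarith

/-- The three defects are nonnegative. Suitable U and V make the left side the nuclear norm of WᵀH.
-/
theorem trace_le_of_partialIsometry {ν : Type*} [Fintype ν] {U : Matrix ι ν ℝ} {V : Matrix κ ν ℝ}
    (hU : U * Uᵀ * U = U) (hV : V * Vᵀ * V = V) (W : Matrix μ ι ℝ) (H : Matrix μ κ ℝ) :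
    (Uᵀ * (Wᵀ * H) * V).trace ≤ (frobSq W + frobSq H) / 2 := by
  have h := two_mul_trace_add_defects hU hV W H
  have h1 := frobSq_nonneg (W * U - H * V)
  have h2 := frobSq_nonneg (W - W * U * Uᵀ)
  have h3 := frobSq_nonneg (H - H * V * Vᵀ)
  linarith

theorem nuclearNorm_eq_sum_fin [DecidableEq κ] (A : Matrix ι κ ℝ) :
    nuclearNorm A = ∑ i : Fin (Fintype.card κ), (Matrix.toEuclideanLin A).singularValues i := by
  rw [nuclearNorm, Finset.sum_range (fun i => (Matrix.toEuclideanLin A).singularValues i) |>.symm]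
  refine Finsupp.sum_of_support_subset _ ?_ _ (by simp)
  intro i hi
  by_contra h
  rw [Finset.mem_range, not_lt] at h
  exact Finsupp.mem_support_iff.1 hi (LinearMap.singularValues_of_finrank_le _ (by simpa using h))

theorem sum_mul_eq_inner (x y : EuclideanSpace ℝ ι) : ∑ l, x l * y l = inner ℝ x y := by
  simp [PiLp.inner_apply, mul_comm]

/-- Right singular vectors: an orthonormal basis (the columns of `V`) on which `A` acts with
orthogonal images whose lengths are the singular values. -/
theorem exists_rightSingularVectors [DecidableEq κ] (A : Matrix ι κ ℝ) :
    ∃ (V : Matrix κ (Fin (Fintype.card κ)) ℝ) (σ : Fin (Fintype.card κ) → ℝ),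
      (∀ i, 0 ≤ σ i) ∧ Vᵀ * V = 1 ∧ V * Vᵀ = 1 ∧
      (A * V)ᵀ * (A * V) = diagonal (fun i => σ i ^ 2) ∧ nuclearNorm A = ∑ i, σ i := by
  set T := Matrix.toEuclideanLin A with hT
  set v := T.isSymmetric_adjoint_comp_self.eigenvectorBasis finrank_euclideanSpace with hv
  have hVV : (Matrix.of fun k i => v i k)ᵀ * (Matrix.of fun k i => v i k) =
      (1 : Matrix (Fin (Fintype.card κ)) _ ℝ) := by
    ext i j
    have := orthonormal_iff_ite.1 v.orthonormal i j
    rw [one_apply, ← this, mul_apply]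
    exact sum_mul_eq_inner (v i) (v j)
  refine ⟨Matrix.of fun k i => v i k, fun i => T.singularValues i,
    fun i => T.singularValues_nonneg i, hVV, ?_, ?_, nuclearNorm_eq_sum_fin A⟩
  · exact (Matrix.mul_eq_one_comm_of_equiv
      (Fintype.equivOfCardEq (by simp))).1 hVV
  · ext i j
    have hA : ∀ l i, (A * Matrix.of fun k i => v i k) l i = T (v i) l := by
      intro l i
      simp [mul_apply, hT, toEuclideanLin, mulVec, dotProduct]
    have hin : inner ℝ (T (v i)) (T (v j)) = (T.singularValues j) ^ 2 * inner ℝ (v i) (v j) := by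
      rw [← LinearMap.adjoint_inner_right, ← LinearMap.comp_apply,
        LinearMap.IsSymmetric.apply_eigenvectorBasis,
        T.sq_singularValues_fin finrank_euclideanSpace]
      rw [← hv, inner_smul_right, RCLike.ofReal_real_eq_id, id]
    rw [orthonormal_iff_ite.1 v.orthonormal i j] at hin
    rw [mul_apply, diagonal_apply]
    simp only [transpose_apply, hA]
    rw [sum_mul_eq_inner, hin]
    split_ifs with h
    · simp [h]
    · simp

/-- The nuclear norm is bounded by every factorization. -/
theorem nuclearNorm_le [DecidableEq κ] (W : Matrix μ ι ℝ) (H : Matrix μ κ ℝ) :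
    nuclearNorm (Wᵀ * H) ≤ (frobSq W + frobSq H) / 2 := by
  obtain ⟨V, σ, hσ, hV, -, hAV, hN⟩ := exists_rightSingularVectors (Wᵀ * H)
  -- The left singular vectors are the normalized columns of AV, where A = WᵀH. Since `0⁻¹ = 0`,
  -- zero singular values give zero columns: a partial isometry, which is all the duality bound
  -- needs.
  have hUU : (Wᵀ * H * V * diagonal fun i => (σ i)⁻¹)ᵀ * (Wᵀ * H * V) = diagonal σ := by
    rw [transpose_mul, Matrix.mul_assoc, hAV, diagonal_transpose, diagonal_mul_diagonal]
    congr 1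
    ext i
    by_cases h : σ i = 0
    · simp [h]
    · field_simp
  have h := trace_le_of_partialIsometry (U := Wᵀ * H * V * diagonal fun i => (σ i)⁻¹) (V := V)
    (by
      rw [Matrix.mul_assoc, ← Matrix.mul_assoc _ᵀ, hUU, Matrix.mul_assoc, diagonal_mul_diagonal,
        diagonal_mul_diagonal]
      congr 2
      ext i
      by_cases h : σ i = 0
      · simp [h]
      · field_simp)
    (by rw [Matrix.mul_assoc, hV, Matrix.mul_one]) W H
  rw [Matrix.mul_assoc, hUU, trace_diagonal] at h
  rwa [hN]

/-- The nuclear norm is attained by a factorization. -/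
theorem exists_factorization [DecidableEq κ] (A : Matrix ι κ ℝ) :
    ∃ (W : Matrix (Fin (Fintype.card κ)) ι ℝ) (H : Matrix (Fin (Fintype.card κ)) κ ℝ),
      Wᵀ * H = A ∧ (frobSq W + frobSq H) / 2 = nuclearNorm A := by
  obtain ⟨V, σ, hσ, hV, hV', hAV, hN⟩ := exists_rightSingularVectors A
  have hsq : ∀ i, √(σ i) * √(σ i) = σ i := fun i => Real.mul_self_sqrt (hσ i)
  refine ⟨(A * V * diagonal fun i => (√(σ i))⁻¹)ᵀ, (diagonal fun i => √(σ i)) * Vᵀ, ?_, ?_⟩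
  -- Dividing and multiplying by √σ kills the columns with σ = 0; nothing is lost, as those columns
  -- of AV have length 0.
  · have hcol : A * V * diagonal (fun i => if σ i = 0 then (0 : ℝ) else 1) = A * V := by
      ext l i
      rw [mul_diagonal]
      split_ifs with h
      · have h0 := congrFun (congrFun hAV i) i
        rw [diagonal_apply_eq, h, mul_apply] at h0
        have := (Finset.sum_eq_zero_iff_of_nonneg
          (fun k _ => mul_self_nonneg ((A * V) k i))).1 (by simpa using h0) l (Finset.mem_univ _)
        rw [mul_self_eq_zero.1 this, zero_mul]
      · rw [mul_one]
    rw [transpose_transpose, Matrix.mul_assoc, ← Matrix.mul_assoc (diagonal _),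
      diagonal_mul_diagonal, ← Matrix.mul_assoc]
    have : (fun i => (√(σ i))⁻¹ * √(σ i)) = fun i => if σ i = 0 then (0 : ℝ) else 1 := by
      ext i
      split_ifs with h
      · simp [h]
      · exact inv_mul_cancel₀ (fun h' => h (by rw [← hsq i, h', zero_mul]))
    rw [this, hcol, Matrix.mul_assoc, hV', Matrix.mul_one]
  · have h1 : frobSq (A * V * diagonal fun i => (√(σ i))⁻¹)ᵀ = ∑ i, σ i := by
      rw [frobSq_eq_trace, trace_mul_comm, transpose_transpose, transpose_mul, Matrix.mul_assoc,
        ← Matrix.mul_assoc (A * V)ᵀ, hAV, diagonal_transpose, diagonal_mul_diagonal,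
        diagonal_mul_diagonal, trace_diagonal]
      refine Finset.sum_congr rfl fun i _ => ?_
      by_cases h : σ i = 0
      · simp [h]
      · have : √(σ i) ≠ 0 := fun h' => h (by rw [← hsq i, h', zero_mul])
        have h2 := hsq i
        field_simp
        rw [sq, h2]
    have h2 : frobSq ((diagonal fun i => √(σ i)) * Vᵀ) = ∑ i, σ i := by
      rw [frobSq_eq_trace, trace_mul_comm, transpose_mul, Matrix.mul_assoc, ← Matrix.mul_assoc Vᵀ,
        transpose_transpose, hV, Matrix.one_mul, diagonal_transpose, diagonal_mul_diagonal,
        trace_diagonal]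
      exact Finset.sum_congr rfl fun i _ => hsq i
    rw [h1, h2, hN]
    ring

/-- Optimal factorizations of A and B, stacked and scaled by 1/√2, factor the midpoint. -/
theorem nuclearNorm_midpoint_le [DecidableEq κ] (A B : Matrix ι κ ℝ) :
    nuclearNorm ((1 / 2 : ℝ) • (A + B)) ≤ (nuclearNorm A + nuclearNorm B) / 2 := by
  obtain ⟨W, H, hA, hA'⟩ := exists_factorization A
  obtain ⟨X, Y, hB, hB'⟩ := exists_factorization B
  have h2 : √(1 / 2 : ℝ) * √(1 / 2) = 1 / 2 := Real.mul_self_sqrt (by norm_num)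
  have key := nuclearNorm_le (√(1 / 2) • fromRows W X) (√(1 / 2) • fromRows H Y)
  rw [frobSq_smul, frobSq_smul, frobSq_fromRows, frobSq_fromRows, sq, h2,
    transpose_smul, Matrix.smul_mul, Matrix.mul_smul, smul_smul, h2,
    transpose_fromRows, fromCols_mul_fromRows, hA, hB] at key
  linarith

/-- Permuting rows and columns does not increase the nuclear norm. -/
theorem nuclearNorm_submatrix_le [DecidableEq κ] (A : Matrix ι κ ℝ) (τ : ι ≃ ι) (e : κ ≃ κ) :
    nuclearNorm (A.submatrix τ e) ≤ nuclearNorm A := by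
  obtain ⟨W, H, hA, hA'⟩ := exists_factorization A
  have key := nuclearNorm_le (W.submatrix id τ) (H.submatrix id e)
  have hm : (W.submatrix id τ)ᵀ * H.submatrix id e = A.submatrix τ e := by
    rw [transpose_submatrix, ← submatrix_mul _ _ _ _ _ Function.bijective_id, hA]
  rwa [frobSq_submatrix, frobSq_submatrix, hm, hA'] at key

end NuclearNorm

/-! ### Convexity and invariance of the cross-entropy. -/

section CrossEntropy

variable {K : ℕ}

theorem sum_exp_pos (z : Fin K → ℝ) (k : Fin K) : 0 < ∑ l, Real.exp (z l) :=
  Finset.sum_pos (fun _ _ => Real.exp_pos _) ⟨k, Finset.mem_univ _⟩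

theorem crossEntropy_nonneg (z : Fin K → ℝ) (k : Fin K) : 0 ≤ crossEntropy z k := by
  rw [crossEntropy, sub_nonneg, Real.le_log_iff_exp_le (sum_exp_pos z k)]
  exact Finset.single_le_sum (fun l _ => (Real.exp_pos (z l)).le) (Finset.mem_univ k)

theorem crossEntropy_add_const (z : Fin K → ℝ) (c : ℝ) (k : Fin K) :
    crossEntropy (fun l => z l + c) k = crossEntropy z k := by
  simp only [crossEntropy, Real.exp_add, ← Finset.sum_mul]
  rw [Real.log_mul (sum_exp_pos z k).ne' (Real.exp_pos c).ne', Real.log_exp]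
  ring

theorem crossEntropy_comp_perm (z : Fin K → ℝ) (τ : Equiv.Perm (Fin K)) (k : Fin K) :
    crossEntropy (fun l => z (τ l)) k = crossEntropy z (τ k) := by
  simp only [crossEntropy]
  rw [Equiv.sum_comp τ fun l => Real.exp (z l)]

/-- The Cauchy-Schwarz inequality with its case of equality. -/
theorem sum_mul_sq_le_and_eq (x y : Fin K → ℝ) (hy : 0 < ∑ l, y l ^ 2) :
    (∑ l, x l * y l) ^ 2 ≤ (∑ l, x l ^ 2) * ∑ l, y l ^ 2 ∧
      ((∑ l, x l * y l) ^ 2 = (∑ l, x l ^ 2) * ∑ l, y l ^ 2 → ∃ t, ∀ l, x l = t * y l) := by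
  refine ⟨Finset.sum_mul_sq_le_sq_mul_sq _ _ _, fun h => ⟨(∑ l, x l * y l) / ∑ l, y l ^ 2, ?_⟩⟩
  set t := (∑ l, x l * y l) / ∑ l, y l ^ 2 with ht
  have h0 : ∑ l, (x l - t * y l) ^ 2 = 0 := by
    have e : ∑ l, (x l - t * y l) ^ 2
        = ∑ l, x l ^ 2 - 2 * t * ∑ l, x l * y l + t ^ 2 * ∑ l, y l ^ 2 := by
      rw [Finset.mul_sum, Finset.mul_sum, ← Finset.sum_sub_distrib, ← Finset.sum_add_distrib]
      exact Finset.sum_congr rfl fun l _ => by ring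
    rw [e, ht]
    field_simp
    linarith
  intro l
  have := (Finset.sum_eq_zero_iff_of_nonneg fun l _ => sq_nonneg (x l - t * y l)).1 h0 l
    (Finset.mem_univ _)
  exact sub_eq_zero.1 (pow_eq_zero_iff two_ne_zero |>.1 this)

theorem sum_exp_midpoint (z w : Fin K → ℝ) :
    ∑ l, Real.exp ((z l + w l) / 2) = ∑ l, Real.exp (z l / 2) * Real.exp (w l / 2) :=
  Finset.sum_congr rfl fun l _ => by rw [← Real.exp_add]; ring_nf

theorem sum_exp_half_sq (z : Fin K → ℝ) :
    ∑ l, Real.exp (z l / 2) ^ 2 = ∑ l, Real.exp (z l) :=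
  Finset.sum_congr rfl fun l _ => by rw [sq, ← Real.exp_add]; ring_nf

theorem two_mul_crossEntropy_midpoint (z w : Fin K → ℝ) (k : Fin K) :
    2 * crossEntropy (fun l => (z l + w l) / 2) k =
      Real.log ((∑ l, Real.exp ((z l + w l) / 2)) ^ 2) - (z k + w k) := by
  rw [crossEntropy, Real.log_pow]
  push_cast
  ring

theorem crossEntropy_add (z w : Fin K → ℝ) (k : Fin K) :
    crossEntropy z k + crossEntropy w k =
      Real.log ((∑ l, Real.exp (z l)) * ∑ l, Real.exp (w l)) - (z k + w k) := by
  rw [Real.log_mul (sum_exp_pos z k).ne' (sum_exp_pos w k).ne', crossEntropy, crossEntropy]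
  ring

/-- This is the logarithm of Cauchy-Schwarz for the vectors exp(z/2) and exp(w/2); the linear parts
cancel. -/
theorem crossEntropy_midpoint_le (z w : Fin K → ℝ) (k : Fin K) :
    crossEntropy (fun l => (z l + w l) / 2) k ≤ (crossEntropy z k + crossEntropy w k) / 2 := by
  have h := (sum_mul_sq_le_and_eq (fun l => Real.exp (z l / 2)) (fun l => Real.exp (w l / 2))
    (by rw [sum_exp_half_sq]; exact sum_exp_pos w k)).1
  rw [← sum_exp_midpoint, sum_exp_half_sq, sum_exp_half_sq] at h
  have h' := Real.log_le_log (pow_pos (sum_exp_pos _ k) 2) h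
  have h1 := two_mul_crossEntropy_midpoint z w k
  have h2 := crossEntropy_add z w k
  linarith

/-- The cross-entropy is strictly convex modulo the constant vectors. -/
theorem exists_const_of_crossEntropy_midpoint (z w : Fin K → ℝ) (k : Fin K)
    (h : crossEntropy (fun l => (z l + w l) / 2) k = (crossEntropy z k + crossEntropy w k) / 2) :
    ∃ c, ∀ l, z l = w l + c := by
  have h1 := two_mul_crossEntropy_midpoint z w k
  have h2 := crossEntropy_add z w k
  have h3 : (∑ l, Real.exp ((z l + w l) / 2)) ^ 2
      = (∑ l, Real.exp (z l)) * ∑ l, Real.exp (w l) :=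
    Real.log_injOn_pos (pow_pos (sum_exp_pos _ k) 2)
      (mul_pos (sum_exp_pos z k) (sum_exp_pos w k)) (by linarith)
  rw [sum_exp_midpoint, ← sum_exp_half_sq, ← sum_exp_half_sq w] at h3
  obtain ⟨t, ht⟩ := (sum_mul_sq_le_and_eq (fun l => Real.exp (z l / 2))
    (fun l => Real.exp (w l / 2)) (by rw [sum_exp_half_sq]; exact sum_exp_pos w k)).2 h3
  have ht0 : t ≠ 0 := by
    rintro rfl
    exact (Real.exp_pos (z k / 2)).ne' (by simpa using ht k)
  refine ⟨2 * Real.log t, fun l => ?_⟩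
  have := congrArg Real.log (ht l)
  rw [Real.log_mul ht0 (Real.exp_pos _).ne', Real.log_exp, Real.log_exp] at this
  linarith

end CrossEntropy

/-! ### Existence, uniqueness and centering for the convex objective. -/

section Objective

variable {K : ℕ} {n : Fin K → ℕ} {lamZ lamb : ℝ}

theorem avgLoss_eq (Z : Matrix (Fin K) (Sample n) ℝ) (b : Fin K → ℝ) :
    avgLoss n Z b = (1 / total n) * ∑ s : Sample n, crossEntropy (fun l => Z l s + b l) s.1 := by
  rw [avgLoss, Fintype.sum_sigma]

theorem total_pos (hK : 0 < K) (hn : ∀ k, 0 < n k) : 0 < total n :=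
  Finset.sum_pos (fun k _ => Nat.cast_pos.2 (hn k)) ⟨⟨0, hK⟩, Finset.mem_univ _⟩

theorem avgLoss_nonneg (Z : Matrix (Fin K) (Sample n) ℝ) (b : Fin K → ℝ) : 0 ≤ avgLoss n Z b := by
  rw [avgLoss_eq]
  have : 0 ≤ total n := Finset.sum_nonneg fun k _ => Nat.cast_nonneg _
  exact mul_nonneg (by positivity) (Finset.sum_nonneg fun s _ => crossEntropy_nonneg _ _)

theorem avgLoss_shift (Z Z' : Matrix (Fin K) (Sample n) ℝ) (b b' : Fin K → ℝ) (c : Sample n → ℝ)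
    (h : ∀ l s, Z' l s + b' l = Z l s + b l + c s) : avgLoss n Z' b' = avgLoss n Z b := by
  rw [avgLoss_eq, avgLoss_eq]
  congr 1
  refine Finset.sum_congr rfl fun s _ => ?_
  simp only [h]
  exact crossEntropy_add_const (fun l => Z l s + b l) (c s) s.1

theorem avgLoss_perm (Z : Matrix (Fin K) (Sample n) ℝ) (b : Fin K → ℝ) (τ : Equiv.Perm (Fin K))
    (e : Equiv.Perm (Sample n)) (he : ∀ s, (e s).1 = τ s.1) :
    avgLoss n (Z.submatrix τ e) (fun k => b (τ k)) = avgLoss n Z b := by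
  rw [avgLoss_eq, avgLoss_eq,
    ← Equiv.sum_comp e fun s => crossEntropy (fun l => Z l s + b l) s.1]
  congr 1
  refine Finset.sum_congr rfl fun s _ => ?_
  rw [he]
  exact crossEntropy_comp_perm (fun l => Z l (e s) + b l) τ s.1

theorem convexObjective_perm_le (hlamZ : 0 < lamZ) (Z : Matrix (Fin K) (Sample n) ℝ)
    (b : Fin K → ℝ) (τ : Equiv.Perm (Fin K)) (e : Equiv.Perm (Sample n))
    (he : ∀ s, (e s).1 = τ s.1) :
    convexObjective n lamZ lamb (Z.submatrix τ e, fun k => b (τ k)) ≤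
      convexObjective n lamZ lamb (Z, b) := by
  simp only [convexObjective]
  rw [avgLoss_perm Z b τ e he, Equiv.sum_comp τ fun k => b k ^ 2]
  have := nuclearNorm_submatrix_le Z τ e
  gcongr

/-- With α = (λ_W/λ_H)^{1/4}, replacing (W, H) by (αW, α⁻¹H) keeps WᵀH and turns the two penalties
into one with common weight λ_Z. -/
theorem rpow_quarter_scaling {lamW lamH : ℝ} (hW : 0 < lamW) (hH : 0 < lamH)
    (hlam : Real.sqrt (lamW * lamH) = lamZ) :
    0 < (lamW / lamH) ^ (1 / 4 : ℝ) ∧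
      (lamH / lamW) ^ (1 / 4 : ℝ) = ((lamW / lamH) ^ (1 / 4 : ℝ))⁻¹ ∧
      lamZ * ((lamW / lamH) ^ (1 / 4 : ℝ)) ^ 2 = lamW ∧
      lamZ * (((lamW / lamH) ^ (1 / 4 : ℝ))⁻¹) ^ 2 = lamH := by
  have h1 : ((lamW / lamH) ^ (1 / 4 : ℝ)) ^ 2 = √lamW / √lamH := by
    rw [← Real.sqrt_div hW.le, Real.sqrt_eq_rpow, ← Real.rpow_natCast,
      ← Real.rpow_mul (by positivity)]
    norm_num
  have hw := Real.mul_self_sqrt hW.le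
  have hh := Real.mul_self_sqrt hH.le
  have hw0 := Real.sqrt_pos.2 hW
  have hh0 := Real.sqrt_pos.2 hH
  refine ⟨by positivity, ?_, ?_, ?_⟩
  · rw [← Real.inv_rpow (by positivity), inv_div]
  · rw [h1, ← hlam, Real.sqrt_mul hW.le]
    field_simp
    linarith
  · rw [inv_pow, h1, ← hlam, Real.sqrt_mul hW.le]
    field_simp
    linarith

theorem convexObjective_le_factorizedObjective {lamW lamH : ℝ} (hW : 0 < lamW) (hH : 0 < lamH)
    (hlam : Real.sqrt (lamW * lamH) = lamZ) {d : ℕ} (W : Matrix (Fin d) (Fin K) ℝ)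
    (H : Matrix (Fin d) (Sample n) ℝ) (b : Fin K → ℝ) :
    convexObjective n lamZ lamb (Wᵀ * H, b) ≤
      factorizedObjective n lamW lamH lamb d (W, H, b) := by
  obtain ⟨hα, -, h1, h2⟩ := rpow_quarter_scaling hW hH hlam
  set α := (lamW / lamH) ^ (1 / 4 : ℝ)
  have hZ : 0 ≤ lamZ := hlam ▸ Real.sqrt_nonneg _
  have h := mul_le_mul_of_nonneg_left (nuclearNorm_le (α • W) (α⁻¹ • H)) hZ
  rw [transpose_smul, Matrix.smul_mul, Matrix.mul_smul, smul_smul, mul_inv_cancel₀ hα.ne',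
    one_smul, frobSq_smul, frobSq_smul] at h
  have e : lamZ * ((α ^ 2 * frobSq W + α⁻¹ ^ 2 * frobSq H) / 2) =
      lamW / 2 * frobSq W + lamH / 2 * frobSq H := by
    linear_combination (frobSq W / 2) * h1 + (frobSq H / 2) * h2
  simp only [convexObjective, factorizedObjective]
  linarith

theorem sum_row_sub_mean_sq (hK : 0 < K) (w : Fin K → ℝ) :
    ∑ l, (w l - (∑ m, w m) / K) ^ 2 = ∑ l, w l ^ 2 - (∑ m, w m) ^ 2 / K := by
  have hK' : (K : ℝ) ≠ 0 := Nat.cast_ne_zero.2 hK.ne'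
  simp only [sub_sq, Finset.sum_add_distrib, Finset.sum_sub_distrib, ← Finset.sum_mul,
    ← Finset.mul_sum, Finset.sum_const, Finset.card_univ, Fintype.card_fin, nsmul_eq_mul]
  field_simp
  ring

/-- The predictions of a minimizer are centered. -/
theorem sum_eq_zero_of_isMinOn (hK : 0 < K) (hlamZ : 0 < lamZ)
    {Z : Matrix (Fin K) (Sample n) ℝ} {b : Fin K → ℝ}
    (h : IsMinOn (convexObjective n lamZ lamb) Set.univ (Z, b)) (s : Sample n) :
    ∑ l, Z l s = 0 := by
  obtain ⟨W, H, hZ, hN⟩ := exists_factorization Z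
  -- Subtracting from each row of W its mean shifts every column of WᵀH by a constant, which the
  -- loss does not see, and lowers ‖W‖² unless all row sums vanish.
  set W' : Matrix (Fin (Fintype.card (Sample n))) (Fin K) ℝ :=
    Matrix.of fun i l => W i l - (∑ m, W i m) / K with hW'
  have hloss : avgLoss n (W'ᵀ * H) b = avgLoss n Z b := by
    refine avgLoss_shift _ _ _ _ (fun s => -∑ i, (∑ m, W i m) / K * H i s) fun l s => ?_
    rw [← hZ]
    simp only [mul_apply, transpose_apply, hW', of_apply, sub_mul, Finset.sum_sub_distrib]
    ring
  have hle := nuclearNorm_le W' H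
  have hmin := h (Set.mem_univ (W'ᵀ * H, b))
  simp only [Set.mem_ofPred_eq, convexObjective, hloss] at hmin
  have hmin' : nuclearNorm Z ≤ nuclearNorm (W'ᵀ * H) :=
    le_of_mul_le_mul_left (by linarith) hlamZ
  have hfrob : frobSq W' = frobSq W - ∑ i, (∑ m, W i m) ^ 2 / K := by
    simp only [frobSq, hW', of_apply, sum_row_sub_mean_sq hK, Finset.sum_sub_distrib]
  have hnn : ∀ i ∈ Finset.univ, 0 ≤ (∑ m, W i m) ^ 2 / (K : ℝ) := fun i _ => by positivity
  have h0 : ∑ i, (∑ m, W i m) ^ 2 / (K : ℝ) = 0 :=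
    le_antisymm (by linarith) (Finset.sum_nonneg hnn)
  have hrow : ∀ i, ∑ m, W i m = 0 := fun i => by
    have := (Finset.sum_eq_zero_iff_of_nonneg hnn).1 h0 i (Finset.mem_univ _)
    rw [div_eq_zero_iff, or_iff_left (Nat.cast_ne_zero.2 hK.ne')] at this
    exact pow_eq_zero_iff two_ne_zero |>.1 this
  rw [← hZ]
  simp only [mul_apply, transpose_apply]
  rw [Finset.sum_comm]
  simp only [← Finset.sum_mul, hrow, zero_mul, Finset.sum_const_zero]

theorem avgLoss_midpoint (Z Z' : Matrix (Fin K) (Sample n) ℝ) (b b' : Fin K → ℝ) :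
    avgLoss n ((1 / 2 : ℝ) • (Z + Z')) ((1 / 2 : ℝ) • (b + b')) =
      (1 / total n) * ∑ s : Sample n,
        crossEntropy (fun l => ((Z l s + b l) + (Z' l s + b' l)) / 2) s.1 := by
  rw [avgLoss_eq]
  congr 1
  refine Finset.sum_congr rfl fun s _ => ?_
  congr 1
  ext l
  simp only [Matrix.smul_apply, Matrix.add_apply, Pi.smul_apply, Pi.add_apply, smul_eq_mul]
  ring

theorem eq_of_isMinOn (hK : 0 < K) (hn : ∀ k, 0 < n k) (hlamZ : 0 < lamZ) (hlamb : 0 < lamb)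
    {Z Z' : Matrix (Fin K) (Sample n) ℝ} {b b' : Fin K → ℝ}
    (h : IsMinOn (convexObjective n lamZ lamb) Set.univ (Z, b))
    (h' : IsMinOn (convexObjective n lamZ lamb) Set.univ (Z', b')) : Z = Z' ∧ b = b' := by
  have hN := total_pos hK hn
  have e1 := h (Set.mem_univ ((1 / 2 : ℝ) • (Z + Z'), (1 / 2 : ℝ) • (b + b')))
  have e2 := h' (Set.mem_univ ((1 / 2 : ℝ) • (Z + Z'), (1 / 2 : ℝ) • (b + b')))
  simp only [Set.mem_ofPred_eq, convexObjective, avgLoss_midpoint] at e1 e2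
  rw [avgLoss_eq] at e1 e2
  have hnuc := mul_le_mul_of_nonneg_left (nuclearNorm_midpoint_le Z Z') hlamZ.le
  -- Parallelogram law: the midpoint gains a multiple of ‖b - b'‖².
  have hb : ∑ k, ((1 / 2 : ℝ) • (b + b')) k ^ 2 =
      (∑ k, b k ^ 2 + ∑ k, b' k ^ 2) / 2 - (∑ k, (b k - b' k) ^ 2) / 4 := by
    rw [← Finset.sum_add_distrib, Finset.sum_div, Finset.sum_div, ← Finset.sum_sub_distrib]
    refine Finset.sum_congr rfl fun k _ => ?_
    simp only [Pi.smul_apply, Pi.add_apply, smul_eq_mul]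
    ring
  rw [hb] at e1 e2
  -- The convexity gap at each sample. Minimality of both pairs forces all gaps, and ‖b - b'‖², to
  -- be zero.
  set g : Sample n → ℝ := fun s =>
    (crossEntropy (fun l => Z l s + b l) s.1 + crossEntropy (fun l => Z' l s + b' l) s.1) / 2
      - crossEntropy (fun l => ((Z l s + b l) + (Z' l s + b' l)) / 2) s.1 with hg
  have hg0 : ∀ s ∈ Finset.univ, 0 ≤ g s := fun s _ =>
    sub_nonneg.2 (crossEntropy_midpoint_le (fun l => Z l s + b l) (fun l => Z' l s + b' l) s.1)
  have hgsum : ∑ s, g s = ((∑ s : Sample n, crossEntropy (fun l => Z l s + b l) s.1) +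
      ∑ s : Sample n, crossEntropy (fun l => Z' l s + b' l) s.1) / 2 -
      ∑ s : Sample n, crossEntropy (fun l => ((Z l s + b l) + (Z' l s + b' l)) / 2) s.1 := by
    rw [hg, Finset.sum_sub_distrib, ← Finset.sum_add_distrib, Finset.sum_div]
  have hbs : 0 ≤ ∑ k, (b k - b' k) ^ 2 := Finset.sum_nonneg fun _ _ => sq_nonneg _
  have hsum : (1 / total n) * ∑ s, g s + lamb / 8 * ∑ k, (b k - b' k) ^ 2 ≤ 0 := by
    rw [hgsum]
    linarith
  have hgs := Finset.sum_nonneg hg0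
  have hA : 0 ≤ (1 / total n) * ∑ s, g s := by positivity
  have hB : 0 ≤ lamb / 8 * ∑ k, (b k - b' k) ^ 2 := by positivity
  have hA0 : ∑ s, g s = 0 := by
    have : (1 / total n) * ∑ s, g s = 0 := by linarith
    exact (mul_eq_zero.1 this).resolve_left (by positivity)
  have hB0 : ∑ k, (b k - b' k) ^ 2 = 0 := by
    have : lamb / 8 * ∑ k, (b k - b' k) ^ 2 = 0 := by linarith
    exact (mul_eq_zero.1 this).resolve_left (by positivity)
  have hbb : b = b' := by
    ext k
    have := (Finset.sum_eq_zero_iff_of_nonneg fun k _ => sq_nonneg (b k - b' k)).1 hB0 k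
      (Finset.mem_univ _)
    exact sub_eq_zero.1 (pow_eq_zero_iff two_ne_zero |>.1 this)
  refine ⟨?_, hbb⟩
  ext l s
  have hs := (Finset.sum_eq_zero_iff_of_nonneg hg0).1 hA0 s (Finset.mem_univ _)
  obtain ⟨c, hc⟩ := exists_const_of_crossEntropy_midpoint (fun l => Z l s + b l)
    (fun l => Z' l s + b' l) s.1 (sub_eq_zero.1 hs).symm
  have hc' : ∀ l, Z l s = Z' l s + c := fun l => by
    have := hc l
    simp only [hbb] at this
    linarith
  have hz := sum_eq_zero_of_isMinOn hK hlamZ h s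
  have hz' := sum_eq_zero_of_isMinOn hK hlamZ h' s
  simp only [hc', Finset.sum_add_distrib, hz', Finset.sum_const, Finset.card_univ,
    Fintype.card_fin, nsmul_eq_mul, zero_add, mul_eq_zero] at hz
  rw [hc', hz.resolve_left (Nat.cast_ne_zero.2 hK.ne'), add_zero]

theorem continuous_factorizedObjective (lamW lamH lamb : ℝ) (d : ℕ) :
    Continuous (factorizedObjective n lamW lamH lamb d) := by
  unfold factorizedObjective
  simp only [avgLoss_eq, crossEntropy, frobSq, mul_apply, transpose_apply]
  have hlog : ∀ s : Sample n, Continuous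
      fun p : Matrix (Fin d) (Fin K) ℝ × Matrix (Fin d) (Sample n) ℝ × (Fin K → ℝ) =>
        Real.log (∑ l, Real.exp (∑ i, p.1 i l * p.2.1 i s + p.2.2 l)) := fun s =>
    Continuous.log (by fun_prop) fun p => (sum_exp_pos _ s.1).ne'
  have hlin : ∀ s : Sample n, Continuous
      fun p : Matrix (Fin d) (Fin K) ℝ × Matrix (Fin d) (Sample n) ℝ × (Fin K → ℝ) =>
        ∑ i, p.1 i s.1 * p.2.1 i s + p.2.2 s.1 := fun s => by fun_prop
  refine Continuous.add (Continuous.add (Continuous.add (Continuous.mul continuous_const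
    (continuous_finsetSum _ fun s _ => (hlog s).sub (hlin s))) ?_) ?_) ?_ <;> fun_prop

/-- The loss is nonnegative and the penalties are coercive, so a sublevel set is bounded and
compactness applies. Here continuity is elementary, unlike for the nuclear norm. -/
theorem exists_isMinOn_factorizedObjective (hlamZ : 0 < lamZ) (hlamb : 0 < lamb) (d : ℕ) :
    ∃ p, IsMinOn (factorizedObjective n lamZ lamZ lamb d) Set.univ p := by
  set f := factorizedObjective n lamZ lamZ lamb d with hf
  set g : (Fin d → Fin K → ℝ) × (Fin d → Sample n → ℝ) × (Fin K → ℝ) → ℝ :=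
    fun q => f (Matrix.of q.1, Matrix.of q.2.1, q.2.2) with hg
  have hgc : Continuous g :=
    (continuous_factorizedObjective lamZ lamZ lamb d).comp (by fun_prop)
  have hlow : ∀ q, lamZ / 2 * frobSq (Matrix.of q.1) + lamZ / 2 * frobSq (Matrix.of q.2.1)
      + lamb / 2 * ∑ k, q.2.2 k ^ 2 ≤ g q := fun q => by
    simp only [hg, hf, factorizedObjective]
    have := avgLoss_nonneg ((Matrix.of q.1)ᵀ * Matrix.of q.2.1) q.2.2
    linarith
  have hg0 : 0 ≤ g 0 := by
    refine le_trans ?_ (hlow 0)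
    have := frobSq_nonneg (Matrix.of (0 : Fin d → Fin K → ℝ))
    have := frobSq_nonneg (Matrix.of (0 : Fin d → Sample n → ℝ))
    have : 0 ≤ ∑ k, (0 : Fin K → ℝ) k ^ 2 := Finset.sum_nonneg fun _ _ => sq_nonneg _
    positivity
  -- Each penalty alone is at most g 0 on the sublevel set of the origin; R bounds every entry
  -- there, hence the sup norm.
  set R := √(g 0 / (lamZ / 2)) + √(g 0 / (lamb / 2)) with hR
  have hsq : ∀ {x c T : ℝ}, 0 < c → c * x ^ 2 ≤ T → |x| ≤ √(T / c) := fun {x c T} hc h => by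
    refine Real.abs_le_sqrt ?_
    rw [le_div_iff₀ hc]
    linarith
  have hent : ∀ {α : Type} [Fintype α] (A : Fin d → α → ℝ) (i : Fin d) (j : α),
      A i j ^ 2 ≤ frobSq (Matrix.of A) := fun {α} _ A i j =>
    (Finset.single_le_sum (f := fun j => A i j ^ 2) (fun _ _ => sq_nonneg _)
      (Finset.mem_univ j)).trans (Finset.single_le_sum (f := fun i => ∑ j, A i j ^ 2)
        (fun _ _ => Finset.sum_nonneg fun _ _ => sq_nonneg _) (Finset.mem_univ i))
  have hbd : ∀ q, g q ≤ g 0 → ‖q‖ ≤ R := fun q hq => by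
    have h0 := (hlow q).trans hq
    have n1 := mul_nonneg (half_pos hlamZ).le (frobSq_nonneg (Matrix.of q.1))
    have n2 := mul_nonneg (half_pos hlamZ).le (frobSq_nonneg (Matrix.of q.2.1))
    have n3 : 0 ≤ lamb / 2 * ∑ k, q.2.2 k ^ 2 :=
      mul_nonneg (half_pos hlamb).le (Finset.sum_nonneg fun _ _ => sq_nonneg _)
    have r1 : √(g 0 / (lamZ / 2)) ≤ R := le_add_of_nonneg_right (Real.sqrt_nonneg _)
    have r2 : √(g 0 / (lamb / 2)) ≤ R := le_add_of_nonneg_left (Real.sqrt_nonneg _)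
    have hR0 : 0 ≤ R := (Real.sqrt_nonneg _).trans r1
    refine norm_prod_le_iff.2 ⟨?_, norm_prod_le_iff.2 ⟨?_, ?_⟩⟩
    · refine (pi_norm_le_iff_of_nonneg hR0).2 fun i => (pi_norm_le_iff_of_nonneg hR0).2 fun j =>
        (hsq (half_pos hlamZ) ?_).trans r1
      have := mul_le_mul_of_nonneg_left (hent q.1 i j) (half_pos hlamZ).le
      linarith
    · refine (pi_norm_le_iff_of_nonneg hR0).2 fun i => (pi_norm_le_iff_of_nonneg hR0).2 fun j =>
        (hsq (half_pos hlamZ) ?_).trans r1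
      have := mul_le_mul_of_nonneg_left (hent q.2.1 i j) (half_pos hlamZ).le
      linarith
    · refine (pi_norm_le_iff_of_nonneg hR0).2 fun i => (hsq (half_pos hlamb) ?_).trans r2
      have := mul_le_mul_of_nonneg_left (Finset.single_le_sum (f := fun k => q.2.2 k ^ 2)
        (fun _ _ => sq_nonneg _) (Finset.mem_univ i)) (half_pos hlamb).le
      linarith
  obtain ⟨q, hq⟩ := hgc.exists_forall_le' 0 (by
    filter_upwards [(isCompact_closedBall (0 : (Fin d → Fin K → ℝ) × (Fin d → Sample n → ℝ) ×
      (Fin K → ℝ)) R).compl_mem_cocompact] with q hq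
    by_contra hlt
    exact hq (mem_closedBall_zero_iff.2 (hbd q (not_le.1 hlt).le)))
  exact ⟨(Matrix.of q.1, Matrix.of q.2.1, q.2.2), fun p _ => hq (p.1, p.2.1, p.2.2)⟩

/-- Feature dimension N suffices for an optimal factorization of every Z, so the product of
minimizing factors minimizes the convex objective. -/
theorem exists_isMinOn (hlamZ : 0 < lamZ) (hlamb : 0 < lamb) :
    ∃ p, IsMinOn (convexObjective n lamZ lamb) Set.univ p := by
  obtain ⟨⟨W, H, b⟩, hp⟩ := exists_isMinOn_factorizedObjective (n := n) hlamZ hlamb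
    (Fintype.card (Sample n))
  refine ⟨(Wᵀ * H, b), fun ⟨Z, c⟩ _ => ?_⟩
  obtain ⟨X, Y, hZ, hN⟩ := exists_factorization Z
  refine (convexObjective_le_factorizedObjective hlamZ hlamZ
    (Real.sqrt_mul_self hlamZ.le) W H b).trans
      (LE.le.trans_eq (hp (Set.mem_univ (X, Y, c)) : _ ≤ _) ?_)
  simp only [factorizedObjective, convexObjective, hZ, ← hN]
  ring

end Objective

/-! ### Matrices invariant under relabeling classes of equal size. -/

section Symmetry

variable {K : ℕ} {n : Fin K → ℕ}

/-- A `K × K` matrix that is unchanged by every relabeling of the classes preserving their sizes. -/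
def ClusterInvariant (n : Fin K → ℕ) (M : Matrix (Fin K) (Fin K) ℝ) : Prop :=
  ∀ τ : Equiv.Perm (Fin K), (∀ k, n (τ k) = n k) → M.submatrix τ τ = M

theorem swap_preserves {k l : Fin K} (h : n k = n l) (m : Fin K) :
    n (Equiv.swap k l m) = n m := by
  rw [Equiv.swap_apply_def]
  split_ifs with h1 h2
  · rw [h1, h]
  · rw [h2, h]
  · rfl

theorem ClusterInvariant.diag_eq {M : Matrix (Fin K) (Fin K) ℝ} (hM : ClusterInvariant n M)
    {k k' : Fin K} (h : n k = n k') : M k k = M k' k' := by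
  have := congrFun (congrFun (hM (Equiv.swap k k') (swap_preserves h)) k) k
  simpa using this.symm

/-- Two transpositions suffice: the first sends k to k', the second sends the image of l to l' and
fixes k'. -/
theorem ClusterInvariant.offDiag_eq {M : Matrix (Fin K) (Fin K) ℝ} (hM : ClusterInvariant n M)
    {k k' l l' : Fin K} (hk : n k = n k') (hl : n l = n l') (hkl : k ≠ l) (hkl' : k' ≠ l') :
    M k l = M k' l' := by
  have h1 : n (Equiv.swap k k' l) = n l' := (swap_preserves hk l).trans hl
  have := congrFun (congrFun (hM (Equiv.swap (Equiv.swap k k' l) l' * Equiv.swap k k')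
    (fun m => by rw [Equiv.Perm.mul_apply, swap_preserves h1, swap_preserves hk])) k) l
  have h2 : Equiv.swap k k' l ≠ k' := fun h => hkl <|
    (Equiv.swap k k').injective ((Equiv.swap_apply_left k k').trans h.symm)
  simp only [submatrix_apply, Equiv.Perm.mul_apply, Equiv.swap_apply_left] at this
  rw [Equiv.swap_apply_of_ne_of_ne h2.symm hkl'] at this
  exact this.symm

theorem ClusterInvariant.mul {M N : Matrix (Fin K) (Fin K) ℝ} (hM : ClusterInvariant n M)
    (hN : ClusterInvariant n N) : ClusterInvariant n (M * N) := fun τ hτ => by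
  rw [submatrix_mul M N τ τ τ τ.bijective, hM τ hτ, hN τ hτ]

theorem ClusterInvariant.transpose {M : Matrix (Fin K) (Fin K) ℝ} (hM : ClusterInvariant n M) :
    ClusterInvariant n Mᵀ := fun τ hτ => by
  rw [← transpose_submatrix, hM τ hτ]

theorem clusterInvariant_diagonal (f : ℕ → ℝ) :
    ClusterInvariant n (diagonal fun k => f (n k)) := fun τ hτ => by
  rw [submatrix_diagonal_equiv]
  congr 1
  ext k
  simp [hτ]

open scoped MatrixOrder Matrix.Norms.L2Operator in
theorem posSemidef_eq_of_mul_self_eq {ι : Type*} [Fintype ι] [DecidableEq ι] {S T : Matrix ι ι ℝ}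
    (hS : S.PosSemidef) (hT : T.PosSemidef) (h : S * S = T * T) : S = T := by
  rw [← CFC.sqrt_unique h hS.nonneg, CFC.sqrt_unique rfl hT.nonneg]

/-- A relabeled S is again a positive semidefinite square root of the same matrix, and such roots
are unique. -/
theorem ClusterInvariant.of_mul_self {S : Matrix (Fin K) (Fin K) ℝ} (hS : S.PosSemidef)
    (h : ClusterInvariant n (S * S)) : ClusterInvariant n S := fun τ hτ =>
  posSemidef_eq_of_mul_self_eq (hS.submatrix τ) hS <| by
    rw [← submatrix_mul S S τ τ τ τ.bijective, h τ hτ]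

/-! ### Coordinates of block matrices; `j k` is the index of the cluster containing `k`. -/

section Blocks

variable {J : ℕ} {Ns : Fin J → ℕ} {j : Fin K → Fin J}

theorem indVec_cluster_apply (hNs : Function.Injective Ns) (hj : ∀ k, Ns (j k) = n k) (i : Fin J)
    (k : Fin K) : indVec (cluster n (Ns i)) k = if j k = i then 1 else 0 := by
  simp only [indVec, cluster, Finset.mem_filter, Finset.mem_univ, true_and, ← hj, hNs.eq_iff]

theorem sum_smul_indVec_apply (hNs : Function.Injective Ns) (hj : ∀ k, Ns (j k) = n k)
    (c : Fin J → ℝ) (k : Fin K) : (∑ i, c i • indVec (cluster n (Ns i))) k = c (j k) := by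
  simp [Finset.sum_apply, indVec_cluster_apply hNs hj]

theorem blockMatrix_apply (hNs : Function.Injective Ns) (hj : ∀ k, Ns (j k) = n k)
    (a : Fin J → ℝ) (A : Fin J → Fin J → ℝ) (k l : Fin K) :
    blockMatrix n Ns a A k l = (if k = l then a (j k) else 0) + A (j k) (j l) := by
  simp only [blockMatrix, Matrix.add_apply, Matrix.sum_apply, Matrix.smul_apply, diagonal_apply,
    vecMulVec_apply, indVec_cluster_apply hNs hj, smul_eq_mul]
  congr 1
  · split_ifs <;> simp
  · simp

theorem sum_blockMatrix (hNs : Function.Injective Ns) (hj : ∀ k, Ns (j k) = n k)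
    (a : Fin J → ℝ) (A : Fin J → Fin J → ℝ) (k : Fin K) :
    ∑ l, blockMatrix n Ns a A l k =
      a (j k) + ∑ i, A i (j k) * ((cluster n (Ns i)).card : ℝ) := by
  have hcard : ∀ i, ((cluster n (Ns i)).card : ℝ) = ∑ l, if j l = i then (1 : ℝ) else 0 := by
    intro i
    simp only [← indVec_cluster_apply hNs hj, indVec]
    simp
  simp only [blockMatrix_apply hNs hj, Finset.sum_add_distrib, hcard, Finset.mul_sum]
  rw [Finset.sum_comm]
  simp

theorem ClusterInvariant.exists_blockMatrix {M : Matrix (Fin K) (Fin K) ℝ}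
    (hM : ClusterInvariant n M) (hNs : Function.Injective Ns) (hr : Set.range Ns = Set.range n) :
    ∃ (a : Fin J → ℝ) (A : Fin J → Fin J → ℝ), M = blockMatrix n Ns a A := by
  have hj' : ∀ k, ∃ i, Ns i = n k := fun k => by
    have : n k ∈ Set.range Ns := hr ▸ Set.mem_range_self k
    exact this
  choose j hj using hj'
  have hoff : ∀ i i', ∃ x, ∀ k l, j k = i → j l = i' → k ≠ l → M k l = x := fun i i' => by
    by_cases h : ∃ k l, j k = i ∧ j l = i' ∧ k ≠ l
    · obtain ⟨k', l', hk', hl', hkl'⟩ := h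
      refine ⟨M k' l', fun k l hk hl hkl => hM.offDiag_eq ?_ ?_ hkl hkl'⟩
      · rw [← hj, ← hj, hk, hk']
      · rw [← hj, ← hj, hl, hl']
    -- No two distinct classes realize this pair of clusters (a singleton paired with itself), so
    -- the coefficient is free.
    · exact ⟨0, fun k l hk hl hkl => absurd ⟨k, l, hk, hl, hkl⟩ h⟩
  have hdiag : ∀ i, ∃ x, ∀ k, j k = i → M k k = x := fun i => by
    by_cases h : ∃ k, j k = i
    · obtain ⟨k', hk'⟩ := h
      refine ⟨M k' k', fun k hk => hM.diag_eq ?_⟩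
      rw [← hj, ← hj, hk, hk']
    · exact ⟨0, fun k hk => absurd ⟨k, hk⟩ h⟩
  choose A hA using hoff
  choose a ha using hdiag
  -- The rank-one term of a cluster also contributes to its diagonal, hence the correction.
  refine ⟨fun i => a i - A i i, A, ?_⟩
  ext k l
  rw [blockMatrix_apply hNs hj]
  split_ifs with h
  · subst h
    rw [ha _ k rfl]
    ring
  · rw [zero_add, hA _ _ k l rfl rfl h]

theorem exists_sum_smul_indVec {b : Fin K → ℝ} (hb : ∀ k l, n k = n l → b k = b l)
    (hNs : Function.Injective Ns) (hr : Set.range Ns = Set.range n) :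
    ∃ c : Fin J → ℝ, b = ∑ i, c i • indVec (cluster n (Ns i)) := by
  have hj' : ∀ k, ∃ i, Ns i = n k := fun k => by
    have : n k ∈ Set.range Ns := hr ▸ Set.mem_range_self k
    exact this
  choose j hj using hj'
  have hr' : ∀ i, ∃ k, n k = Ns i := fun i => by
    have : Ns i ∈ Set.range n := hr ▸ Set.mem_range_self i
    exact this
  choose r hr' using hr'
  refine ⟨fun i => b (r i), ?_⟩
  ext k
  rw [sum_smul_indVec_apply hNs hj]
  exact hb _ _ (by rw [hr', hj])

end Blocks

theorem inner_colVec {ι κ : Type*} [Fintype ι] (M : Matrix ι κ ℝ) (k l : κ) :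
    inner ℝ (colVec M k) (colVec M l) = (Mᵀ * M) k l :=
  (sum_mul_eq_inner (colVec M k) (colVec M l)).symm

/-- Angles depend only on the entries of the Gram matrix. -/
theorem equalAngles_of_clusterInvariant {ι : Type*} [Fintype ι] {M : Matrix ι (Fin K) ℝ}
    (h : ClusterInvariant n (Mᵀ * M)) : EqualAngles n M := by
  intro m k hk l hl k' hk' l' hl' hkl hkl'
  simp only [cluster, Finset.mem_filter, Finset.mem_univ, true_and] at hk hl hk' hl'
  have hnorm : ∀ k, ‖colVec M k‖ = √((Mᵀ * M) k k) := fun k => by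
    rw [← inner_colVec, real_inner_self_eq_norm_sq, Real.sqrt_sq (norm_nonneg _)]
  simp only [InnerProductGeometry.angle, inner_colVec, hnorm]
  rw [h.offDiag_eq (hk.trans hk'.symm) (hl.trans hl'.symm) hkl hkl',
    h.diag_eq (hk.trans hk'.symm), h.diag_eq (hl.trans hl'.symm)]

end Symmetry

/-! ### Symmetries of the minimizer. -/

section Minimizer

variable {K : ℕ} {n : Fin K → ℕ} {lamZ lamb : ℝ} {Z : Matrix (Fin K) (Sample n) ℝ} {b : Fin K → ℝ}

/-- The permuted pair does no worse, so it is a minimizer too, and uniqueness identifies the two. -/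
theorem perm_of_isMinOn (hK : 0 < K) (hn : ∀ k, 0 < n k) (hlamZ : 0 < lamZ) (hlamb : 0 < lamb)
    (h : IsMinOn (convexObjective n lamZ lamb) Set.univ (Z, b)) (τ : Equiv.Perm (Fin K))
    (e : Equiv.Perm (Sample n)) (he : ∀ s, (e s).1 = τ s.1) :
    Z.submatrix τ e = Z ∧ (fun k => b (τ k)) = b :=
  eq_of_isMinOn hK hn hlamZ hlamb
    (fun _ hq => (convexObjective_perm_le hlamZ Z b τ e he).trans (h hq)) h

theorem eq_classMean_of_isMinOn (hK : 0 < K) (hn : ∀ k, 0 < n k) (hlamZ : 0 < lamZ)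
    (hlamb : 0 < lamb) (h : IsMinOn (convexObjective n lamZ lamb) Set.univ (Z, b)) (k : Fin K)
    (i : Fin (n k)) (l : Fin K) : Z l ⟨k, i⟩ = classMean n Z l k := by
  have hi : ∀ i', Z l ⟨k, i'⟩ = Z l ⟨k, i⟩ := fun i' => by
    -- Exchanging two samples of the same class is a symmetry that moves no class.
    have := (perm_of_isMinOn hK hn hlamZ hlamb h 1 (Equiv.swap ⟨k, i⟩ ⟨k, i'⟩) (fun s => by
      rw [Equiv.swap_apply_def]
      split_ifs with h1 h2
      · simp [h1]
      · simp [h2]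
      · rfl)).1
    simpa using congrFun (congrFun this l) ⟨k, i⟩
  have : (n k : ℝ) ≠ 0 := Nat.cast_ne_zero.2 (hn k).ne'
  simp only [classMean, of_apply, hi, Finset.sum_const, Finset.card_univ, Fintype.card_fin,
    nsmul_eq_mul]
  field_simp

theorem mul_labels_apply {ι : Type*} (M : Matrix ι (Fin K) ℝ) (l : ι) (s : Sample n) :
    (M * labels n) l s = M l s.1 := by
  simp [mul_apply, labels]

theorem clusterInvariant_classMean (hK : 0 < K) (hn : ∀ k, 0 < n k) (hlamZ : 0 < lamZ)
    (hlamb : 0 < lamb) (h : IsMinOn (convexObjective n lamZ lamb) Set.univ (Z, b)) :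
    ClusterInvariant n (classMean n Z) ∧
      ∀ τ : Equiv.Perm (Fin K), (∀ k, n (τ k) = n k) → ∀ k, b (τ k) = b k := by
  have key := fun (τ : Equiv.Perm (Fin K)) (hτ : ∀ k, n (τ k) = n k) =>
    perm_of_isMinOn hK hn hlamZ hlamb h τ
      (Equiv.sigmaCongr τ fun k => finCongr (hτ k).symm) fun s => rfl
  refine ⟨fun τ hτ => ?_, fun τ hτ k => congrFun (key τ hτ).2 k⟩
  ext l k
  have h1 := congrFun (congrFun (key τ hτ).1 l) ⟨k, ⟨0, hn k⟩⟩
  rw [eq_classMean_of_isMinOn hK hn hlamZ hlamb h] at h1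
  rw [← h1, submatrix_apply, submatrix_apply]
  exact (eq_classMean_of_isMinOn hK hn hlamZ hlamb h _ _ _).symm

end Minimizer

/-! ### Singular value decompositions and optimal factorizations. -/

section SVD

variable {ι κ ν : Type*} [Fintype ι] [Fintype κ] [Fintype ν] [DecidableEq ν]

theorem diagonal_sqrt_mul_self {σ : ν → ℝ} (hσ : ∀ k, 0 ≤ σ k) :
    (diagonal fun k => √(σ k)) * (diagonal fun k => √(σ k)) = diagonal σ := by
  rw [diagonal_mul_diagonal]
  congr 1
  ext k
  exact Real.mul_self_sqrt (hσ k)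

theorem frobSq_diagonal_sqrt_mul {σ : ν → ℝ} (hσ : ∀ k, 0 ≤ σ k) {X : Matrix ι ν ℝ}
    (hX : Xᵀ * X = 1) : frobSq ((diagonal fun k => √(σ k)) * Xᵀ) = ∑ k, σ k := by
  rw [frobSq_eq_trace, trace_mul_comm, transpose_mul, Matrix.mul_assoc, ← Matrix.mul_assoc Xᵀ,
    transpose_transpose, hX, Matrix.one_mul, diagonal_transpose, diagonal_sqrt_mul_self hσ,
    trace_diagonal]

theorem trace_svd {U : Matrix ι ν ℝ} {V : Matrix κ ν ℝ} (hU : Uᵀ * U = 1) (hV : Vᵀ * V = 1)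
    (σ : ν → ℝ) : (Uᵀ * (U * diagonal σ * Vᵀ) * V).trace = ∑ k, σ k := by
  rw [Matrix.mul_assoc, Matrix.mul_assoc, Matrix.mul_assoc, hV, Matrix.mul_one,
    ← Matrix.mul_assoc, hU, Matrix.one_mul, trace_diagonal]

theorem partialIsometry_of_isometry {U : Matrix ι ν ℝ} (hU : Uᵀ * U = 1) : U * Uᵀ * U = U := by
  rw [Matrix.mul_assoc, hU, Matrix.mul_one]

theorem nuclearNorm_svd [DecidableEq κ] {U : Matrix ι ν ℝ} {V : Matrix κ ν ℝ}
    (hU : Uᵀ * U = 1) (hV : Vᵀ * V = 1) {σ : ν → ℝ} (hσ : ∀ k, 0 ≤ σ k) :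
    nuclearNorm (U * diagonal σ * Vᵀ) = ∑ k, σ k := by
  apply le_antisymm
  · have h := nuclearNorm_le ((diagonal fun k => √(σ k)) * Uᵀ) ((diagonal fun k => √(σ k)) * Vᵀ)
    rw [frobSq_diagonal_sqrt_mul hσ hU, frobSq_diagonal_sqrt_mul hσ hV, transpose_mul,
      transpose_transpose, diagonal_transpose, Matrix.mul_assoc, ← Matrix.mul_assoc (diagonal _),
      diagonal_sqrt_mul_self hσ, ← Matrix.mul_assoc] at h
    linarith
  · obtain ⟨W, H, hA, hN⟩ := exists_factorization (U * diagonal σ * Vᵀ)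
    rw [← hN, ← trace_svd hU hV σ, ← hA]
    exact trace_le_of_partialIsometry (partialIsometry_of_isometry hU)
      (partialIsometry_of_isometry hV) W H

/-- A matrix with orthogonal columns is a matrix with orthonormal columns times a diagonal one. -/
theorem exists_isometry_mul_diagonal {K d : ℕ} (hd : K ≤ d) {M : Matrix (Fin d) (Fin K) ℝ}
    {σ : Fin K → ℝ} (hσ : ∀ k, 0 ≤ σ k) (hM : Mᵀ * M = diagonal σ) :
    ∃ Q : Matrix (Fin d) (Fin K) ℝ, Qᵀ * Q = 1 ∧ M = Q * diagonal fun k => √(σ k) := by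
  have hinner : ∀ k l, inner ℝ (colVec M k) (colVec M l) = if k = l then σ k else 0 := by
    intro k l
    rw [inner_colVec, hM, diagonal_apply]
  set v : Fin d → EuclideanSpace ℝ (Fin d) := fun i =>
    if h : (i : ℕ) < K then (√(σ ⟨i, h⟩))⁻¹ • colVec M ⟨i, h⟩ else 0 with hv
  have hvk : ∀ k : Fin K, v (Fin.castLE hd k) = (√(σ k))⁻¹ • colVec M k := fun k => by
    simp [hv]
  -- Only columns with σ k ≠ 0 can be normalized. The others are zero, so an arbitrary completion to
  -- an orthonormal basis supplies the remaining columns of Q.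
  set s : Set (Fin d) := {i | ∃ k, Fin.castLE hd k = i ∧ σ k ≠ 0} with hs
  have hon : Orthonormal ℝ (s.domRestrict v) := by
    rw [orthonormal_iff_ite]
    rintro ⟨_, k, rfl, hk⟩ ⟨_, l, rfl, hl⟩
    simp only [Subtype.mk.injEq, (Fin.castLE_injective hd).eq_iff]
    change inner ℝ (v (Fin.castLE hd k)) (v (Fin.castLE hd l)) = _
    rw [hvk, hvk, real_inner_smul_left, real_inner_smul_right, hinner]
    split_ifs with h
    · subst h
      have h1 := Real.mul_self_sqrt (hσ k)
      have h2 : √(σ k) ≠ 0 := fun h => hk (by rw [← h1, h, zero_mul])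
      field_simp
      rw [sq, h1]
    · simp
  obtain ⟨B, hB⟩ := hon.exists_orthonormalBasis_extension_of_card_eq (by simp)
  refine ⟨Matrix.of fun r k => B (Fin.castLE hd k) r, ?_, ?_⟩
  · ext k l
    rw [mul_apply, one_apply]
    refine (sum_mul_eq_inner (B (Fin.castLE hd k)) (B (Fin.castLE hd l))).trans ?_
    rw [orthonormal_iff_ite.1 B.orthonormal]
    simp only [(Fin.castLE_injective hd).eq_iff]
  · ext r k
    rw [mul_diagonal, of_apply]
    by_cases hk : σ k = 0
    · have h0 : colVec M k = 0 := inner_self_eq_zero.1 ((hinner k k).trans (by simp [hk]))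
      have : M r k = colVec M k r := rfl
      simp [this, h0, hk]
    · have h1 := Real.mul_self_sqrt (hσ k)
      have h2 : √(σ k) ≠ 0 := fun h => hk (by rw [← h1, h, zero_mul])
      rw [hB _ ⟨k, rfl, hk⟩, hvk]
      simp only [PiLp.smul_apply, smul_eq_mul]
      field_simp
      rfl

/-- The factorizations attaining the nuclear norm are determined up to an isometry. -/
theorem exists_isometry_of_optimal_factorization {K d : ℕ} (hd : K ≤ d) {U : Matrix ι (Fin K) ℝ}
    {V : Matrix κ (Fin K) ℝ} (hU : Uᵀ * U = 1) (hV : Vᵀ * V = 1) {σ : Fin K → ℝ}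
    (hσ : ∀ k, 0 ≤ σ k) {W : Matrix (Fin d) ι ℝ} {H : Matrix (Fin d) κ ℝ}
    (hWH : Wᵀ * H = U * diagonal σ * Vᵀ) (hopt : (frobSq W + frobSq H) / 2 ≤ ∑ k, σ k) :
    ∃ Q : Matrix (Fin d) (Fin K) ℝ, Qᵀ * Q = 1 ∧
      W = Q * ((diagonal fun k => √(σ k)) * Uᵀ) ∧ H = Q * ((diagonal fun k => √(σ k)) * Vᵀ) := by
  have h := two_mul_trace_add_defects (partialIsometry_of_isometry hU)
    (partialIsometry_of_isometry hV) W H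
  rw [hWH, trace_svd hU hV] at h
  have n1 := frobSq_nonneg (W * U - H * V)
  have n2 := frobSq_nonneg (W - W * U * Uᵀ)
  have n3 := frobSq_nonneg (H - H * V * Vᵀ)
  have e1 := sub_eq_zero.1 (frobSq_eq_zero (le_antisymm (by linarith) n1))
  have e2 := sub_eq_zero.1 (frobSq_eq_zero (le_antisymm (by linarith) n2))
  have e3 := sub_eq_zero.1 (frobSq_eq_zero (le_antisymm (by linarith) n3))
  -- Replacing one factor WU by HV turns the Gram matrix into Uᵀ(WᵀH)V.
  have hM : (W * U)ᵀ * (W * U) = diagonal σ := by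
    nth_rewrite 2 [e1]
    rw [transpose_mul, Matrix.mul_assoc, ← Matrix.mul_assoc Wᵀ, hWH, Matrix.mul_assoc,
      Matrix.mul_assoc, hV, Matrix.mul_one, ← Matrix.mul_assoc, hU, Matrix.one_mul]
  obtain ⟨Q, hQ, hMQ⟩ := exists_isometry_mul_diagonal hd hσ hM
  refine ⟨Q, hQ, ?_, ?_⟩
  · rw [← Matrix.mul_assoc, ← hMQ, ← e2]
  · rw [← Matrix.mul_assoc, ← hMQ, e1, ← e3]

theorem exists_isometry {K d : ℕ} (hd : K ≤ d) :
    ∃ Q : Matrix (Fin d) (Fin K) ℝ, Qᵀ * Q = 1 := by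
  obtain ⟨Q, hQ, -⟩ := exists_isometry_mul_diagonal (M := (0 : Matrix (Fin d) (Fin K) ℝ)) hd
    (σ := 0) (fun _ => le_rfl) (by simp)
  exact ⟨Q, hQ⟩

end SVD

/-! ### Global minimizers of the factorized model. -/

section Factorized

variable {K : ℕ} {n : Fin K → ℕ} {lamZ lamb : ℝ} {Z : Matrix (Fin K) (Sample n) ℝ} {b : Fin K → ℝ}

theorem labels_mul_transpose : labels n * (labels n)ᵀ = diagonal fun k => (n k : ℝ) := by
  ext k l
  rw [mul_apply, Fintype.sum_sigma, diagonal_apply]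
  simp only [labels, of_apply, transpose_apply]
  split_ifs with h
  · subst h
    simp [Finset.sum_ite_eq, ← ite_and]
  · refine Finset.sum_eq_zero fun m _ => Finset.sum_eq_zero fun i _ => ?_
    by_cases hk : k = m
    · subst hk
      simp [Ne.symm h]
    · simp [hk]

/-- As YYᵀ = D, the matrix YᵀD^{-1/2} has orthonormal columns; it lifts the right singular vectors
of Z̄D^{1/2} to those of Z. -/
theorem isometry_labels (hn : ∀ k, 0 < n k) {V : Matrix (Fin K) (Fin K) ℝ} (hV : Vᵀ * V = 1) :
    ((labels n)ᵀ * (diagonal (fun k => (√(n k : ℝ))⁻¹) * V))ᵀ *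
      ((labels n)ᵀ * (diagonal (fun k => (√(n k : ℝ))⁻¹) * V)) = 1 := by
  rw [transpose_mul, transpose_transpose, Matrix.mul_assoc, ← Matrix.mul_assoc (labels n),
    labels_mul_transpose, ← Matrix.mul_assoc (diagonal _), diagonal_mul_diagonal, transpose_mul,
    Matrix.mul_assoc, diagonal_transpose, ← Matrix.mul_assoc (diagonal _), diagonal_mul_diagonal]
  have : (fun k => (√(n k : ℝ))⁻¹ * ((n k : ℝ) * (√(n k : ℝ))⁻¹)) = fun _ => 1 := by
    ext k
    have h0 : (0 : ℝ) < n k := Nat.cast_pos.2 (hn k)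
    have h1 := Real.mul_self_sqrt h0.le
    have h2 := Real.sqrt_pos.2 h0
    field_simp
    rw [sq, h1]
  rw [this, diagonal_one, Matrix.one_mul, hV]

/-- The global minimizers of the factorized model, in terms of a singular value decomposition
`Z = U Σ Vᵀ` of the minimizer of the convex model. -/
theorem isMinOn_factorizedObjective_iff (hK : 0 < K) (hn : ∀ k, 0 < n k) (hlamZ : 0 < lamZ)
    (hlamb : 0 < lamb) (h : IsMinOn (convexObjective n lamZ lamb) Set.univ (Z, b))
    {U : Matrix (Fin K) (Fin K) ℝ} {V : Matrix (Sample n) (Fin K) ℝ} {σ : Fin K → ℝ}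
    (hU : Uᵀ * U = 1) (hV : Vᵀ * V = 1) (hσ : ∀ k, 0 ≤ σ k) (hZ : Z = U * diagonal σ * Vᵀ)
    {lamW lamH : ℝ} (hW : 0 < lamW) (hH : 0 < lamH) (hlam : Real.sqrt (lamW * lamH) = lamZ)
    {d : ℕ} (hd : K ≤ d) (W' : Matrix (Fin d) (Fin K) ℝ) (H' : Matrix (Fin d) (Sample n) ℝ)
    (b' : Fin K → ℝ) :
    IsMinOn (factorizedObjective n lamW lamH lamb d) Set.univ (W', H', b') ↔
      b' = b ∧ ∃ Q : Matrix (Fin d) (Fin K) ℝ, Qᵀ * Q = 1 ∧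
        W' = (lamH / lamW) ^ (1 / 4 : ℝ) • (Q * ((diagonal fun k => √(σ k)) * Uᵀ)) ∧
        H' = (lamW / lamH) ^ (1 / 4 : ℝ) • (Q * ((diagonal fun k => √(σ k)) * Vᵀ)) := by
  obtain ⟨hα, hα', h1, h2⟩ := rpow_quarter_scaling hW hH hlam
  rw [hα']
  set α := (lamW / lamH) ^ (1 / 4 : ℝ)
  have hnuc : nuclearNorm Z = ∑ k, σ k := by rw [hZ, nuclearNorm_svd hU hV hσ]
  have hval : ∀ Q : Matrix (Fin d) (Fin K) ℝ, Qᵀ * Q = 1 →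
      factorizedObjective n lamW lamH lamb d
        (α⁻¹ • (Q * ((diagonal fun k => √(σ k)) * Uᵀ)),
          α • (Q * ((diagonal fun k => √(σ k)) * Vᵀ)), b) =
        convexObjective n lamZ lamb (Z, b) := fun Q hQ => by
    have hmul : (α⁻¹ • (Q * ((diagonal fun k => √(σ k)) * Uᵀ)))ᵀ *
        α • (Q * ((diagonal fun k => √(σ k)) * Vᵀ)) = Z := by
      rw [transpose_smul, Matrix.smul_mul, Matrix.mul_smul, smul_smul, inv_mul_cancel₀ hα.ne',
        one_smul, transpose_mul, Matrix.mul_assoc, ← Matrix.mul_assoc Qᵀ, hQ, Matrix.one_mul,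
        transpose_mul, transpose_transpose, diagonal_transpose, Matrix.mul_assoc,
        ← Matrix.mul_assoc (diagonal _), diagonal_sqrt_mul_self hσ, ← Matrix.mul_assoc, hZ]
    simp only [factorizedObjective, convexObjective, hmul, frobSq_smul, frobSq_isometry_mul hQ,
      frobSq_diagonal_sqrt_mul hσ hU, frobSq_diagonal_sqrt_mul hσ hV, hnuc]
    have e1 : lamW * α⁻¹ ^ 2 = lamZ := by
      rw [← h1]
      field_simp
    have e2 : lamH * α ^ 2 = lamZ := by
      rw [← h2]
      field_simp
    linear_combination ((∑ k, σ k) / 2) * e1 + ((∑ k, σ k) / 2) * e2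
  constructor
  · intro hmin
    obtain ⟨Q₀, hQ₀⟩ := exists_isometry hd
    have hle : factorizedObjective n lamW lamH lamb d (W', H', b') ≤
        convexObjective n lamZ lamb (Z, b) := by
      rw [← hval Q₀ hQ₀]
      exact hmin (Set.mem_univ _)
    have hge := convexObjective_le_factorizedObjective (lamb := lamb) hW hH hlam W' H' b'
    obtain ⟨hZ', hb'⟩ := eq_of_isMinOn hK hn hlamZ hlamb
      (fun _ hq => (hge.trans hle).trans (h hq)) h
    refine ⟨hb', ?_⟩
    have hopt : (frobSq (α • W') + frobSq (α⁻¹ • H')) / 2 ≤ ∑ k, σ k := by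
      simp only [factorizedObjective, convexObjective, hZ', hb', hnuc] at hle
      refine le_of_mul_le_mul_left ?_ hlamZ
      rw [frobSq_smul, frobSq_smul]
      have e : lamZ * ((α ^ 2 * frobSq W' + α⁻¹ ^ 2 * frobSq H') / 2) =
          lamW / 2 * frobSq W' + lamH / 2 * frobSq H' := by
        linear_combination (frobSq W' / 2) * h1 + (frobSq H' / 2) * h2
      linarith
    obtain ⟨Q, hQ, hQW, hQH⟩ := exists_isometry_of_optimal_factorization hd hU hV hσ
      (W := α • W') (H := α⁻¹ • H') (by
        rw [transpose_smul, Matrix.smul_mul, Matrix.mul_smul, smul_smul, mul_inv_cancel₀ hα.ne',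
          one_smul, hZ', hZ]) hopt
    refine ⟨Q, hQ, ?_, ?_⟩
    · rw [← hQW, smul_smul, inv_mul_cancel₀ hα.ne', one_smul]
    · rw [← hQH, smul_smul, mul_inv_cancel₀ hα.ne', one_smul]
  · rintro ⟨rfl, Q, hQ, rfl, rfl⟩ ⟨X, Y, c⟩ -
    refine (hval Q hQ).trans_le ?_
    exact LE.le.trans (h (Set.mem_univ (Xᵀ * Y, c)) : _ ≤ _)
      (convexObjective_le_factorizedObjective hW hH hlam X Y c)

end Factorized

/-! ### The scalar problem of the balanced case. -/

section Scalar

open Filter Topology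

theorem hasDerivAt_log_exp_add {κ : ℝ} (hκ : 0 < κ) (c x : ℝ) :
    HasDerivAt (fun y => Real.log (Real.exp y + κ) - y + c * y)
      (Real.exp x / (Real.exp x + κ) - 1 + c) x := by
  have h := (((Real.hasDerivAt_exp x).add_const κ).log
    (by have := Real.exp_pos x; positivity)).sub (hasDerivAt_id x)
  convert! h.add ((hasDerivAt_id x).const_mul c) using 1
  simp

/-- The minimizer of the scalar problem to which the balanced case reduces. -/
theorem scalar_minimizer {κ q x : ℝ} (hκ : 0 < κ) (hq : 0 < q)
    (hmin : ∀ y, Real.log (Real.exp x + κ) - x + κ * q * |x| ≤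
      Real.log (Real.exp y + κ) - y + κ * q * |y|) :
    (1 ≤ q * (κ + 1) → x = 0) ∧ (q * (κ + 1) < 1 → x = Real.log (1 / q - κ)) := by
  have hx := Real.exp_pos x
  rcases lt_trichotomy x 0 with hx0 | hx0 | hx0
  · exfalso
    have hloc : IsLocalMin (fun y => Real.log (Real.exp y + κ) - y + -(κ * q) * y) x := by
      filter_upwards [eventually_lt_nhds hx0] with y hy
      have := hmin y
      rw [abs_of_neg hx0, abs_of_neg hy] at this
      linarith
    have h0 := hloc.hasDerivAt_eq_zero (hasDerivAt_log_exp_add hκ _ x)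
    have h1 : Real.exp x / (Real.exp x + κ) < 1 := (div_lt_one (by positivity)).2 (by linarith)
    have h2 : 0 < κ * q := by positivity
    linarith
  · refine ⟨fun _ => hx0, fun hlt => ?_⟩
    exfalso
    subst hx0
    have hd := (hasDerivAt_log_exp_add hκ (κ * q) 0).hasDerivWithinAt (s := Set.Ioi 0)
    have hneg : Real.exp 0 / (Real.exp 0 + κ) - 1 + κ * q < 0 := by
      rw [Real.exp_zero, show 1 / (1 + κ) - 1 + κ * q = κ * (q * (κ + 1) - 1) / (1 + κ) by
        field_simp; ring]
      exact div_neg_of_neg_of_pos (mul_neg_of_pos_of_neg hκ (by linarith)) (by linarith)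
    -- A negative right derivative at 0 yields some y > 0 with a smaller value.
    have hev := hd.limsup_slope_le' (by simp) hneg
    obtain ⟨y, hy, hy0⟩ := (hev.and self_mem_nhdsWithin).exists
    have hy0 : 0 < y := hy0
    rw [slope_def_field, div_lt_iff₀ (by linarith)] at hy
    have := hmin y
    rw [abs_of_pos hy0, abs_zero] at this
    linarith
  · have hloc : IsLocalMin (fun y => Real.log (Real.exp y + κ) - y + κ * q * y) x := by
      filter_upwards [eventually_gt_nhds hx0] with y hy
      have := hmin y
      rwa [abs_of_pos hx0, abs_of_pos hy] at this
    have h0 := hloc.hasDerivAt_eq_zero (hasDerivAt_log_exp_add hκ _ x)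
    have h1 : q * (Real.exp x + κ) = 1 := by
      field_simp at h0
      have : κ * (q * (Real.exp x + κ) - 1) = 0 := by linarith
      linarith [(mul_eq_zero.1 this).resolve_left hκ.ne']
    refine ⟨fun h => ?_, fun _ => ?_⟩
    · exfalso
      have := Real.one_lt_exp_iff.2 hx0
      nlinarith
    · have : 1 / q - κ = Real.exp x := by
        rw [← h1]
        field_simp
        ring
      rw [this, Real.log_exp]

end Scalar

/-! ### Equal class sizes. -/

section Balanced

variable {K : ℕ} {n : Fin K → ℕ} {lamZ lamb : ℝ} {Z : Matrix (Fin K) (Sample n) ℝ} {b : Fin K → ℝ}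

/-- The simplex matrix `K I - J`. -/
def simplexMatrix (K : ℕ) : Matrix (Fin K) (Fin K) ℝ :=
  (K : ℝ) • (1 : Matrix (Fin K) (Fin K) ℝ) - Matrix.of fun _ _ => 1

theorem simplexMatrix_apply (k l : Fin K) :
    simplexMatrix K k l = (if k = l then (K : ℝ) else 0) - 1 := by
  simp [simplexMatrix, one_apply]

theorem simplexMatrix_transpose : (simplexMatrix K)ᵀ = simplexMatrix K := by
  ext k l
  simp only [transpose_apply, simplexMatrix_apply, eq_comm]

theorem simplexMatrix_mul_self : simplexMatrix K * simplexMatrix K = (K : ℝ) • simplexMatrix K := by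
  ext k l
  simp only [mul_apply, simplexMatrix_apply, Matrix.smul_apply, smul_eq_mul, sub_mul, mul_sub,
    Finset.sum_sub_distrib]
  simp

theorem trace_simplexMatrix : (simplexMatrix K).trace = K * (K - 1) := by
  simp [trace, simplexMatrix_apply, mul_sub]

theorem nuclearNorm_neg {ι κ : Type*} [Fintype ι] [Fintype κ] [DecidableEq κ] (A : Matrix ι κ ℝ) :
    nuclearNorm (-A) = nuclearNorm A := by
  have h : ∀ B : Matrix ι κ ℝ, nuclearNorm (-B) ≤ nuclearNorm B := fun B => by
    obtain ⟨W, H, rfl, hN⟩ := exists_factorization B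
    have := nuclearNorm_le (-W) H
    have hf : frobSq (-W) = frobSq W := by simp [frobSq]
    rwa [transpose_neg, Matrix.neg_mul, hf, hN] at this
  exact le_antisymm (h A) (by simpa using h (-A))

theorem labels_mul_transpose_of_balanced {m : ℕ} (hm : ∀ k, n k = m) :
    labels n * (labels n)ᵀ = (m : ℝ) • (1 : Matrix (Fin K) (Fin K) ℝ) := by
  rw [labels_mul_transpose, smul_one_eq_diagonal]
  simp only [hm]

/-- With S = KI - J, S² = KS and YYᵀ = mI make S/K a projection and (SY)ᵀ/(K√m) a partial isometry;
these are dual certificates for the lower bound. -/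
theorem nuclearNorm_simplex_of_nonneg (hK : 0 < K) {m : ℕ} (hm0 : 0 < m)
    (hm : ∀ k, n k = m) {t : ℝ}
    (ht : 0 ≤ t) :
    nuclearNorm (t • (simplexMatrix K * labels n)) = t * K * (K - 1) * √m := by
  set S := simplexMatrix K
  have hK' : (0 : ℝ) < K := Nat.cast_pos.2 hK
  have hm' : (0 : ℝ) < m := Nat.cast_pos.2 hm0
  have hsq := Real.mul_self_sqrt hm'.le
  have hs0 := Real.sqrt_pos.2 hm'
  have hYS : labels n * (S * labels n)ᵀ = (m : ℝ) • S := by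
    rw [transpose_mul, simplexMatrix_transpose, ← Matrix.mul_assoc,
      labels_mul_transpose_of_balanced hm, Matrix.smul_mul,
      Matrix.one_mul]
  have hSYS : S * labels n * (S * labels n)ᵀ = ((m : ℝ) * K) • S := by
    rw [Matrix.mul_assoc, hYS, Matrix.mul_smul, simplexMatrix_mul_self, smul_smul]
  have hfS : frobSq S = K * (K * (K - 1)) := by
    rw [frobSq_eq_trace, simplexMatrix_transpose, simplexMatrix_mul_self, trace_smul,
      trace_simplexMatrix, smul_eq_mul]
  have hfSY : frobSq (S * labels n) = m * K * (K * (K - 1)) := by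
    rw [frobSq_eq_trace, trace_mul_comm, hSYS, trace_smul, trace_simplexMatrix, smul_eq_mul]
  apply le_antisymm
  -- This constant makes the product of the two factors t SY and their Frobenius norms equal.
  · have hc := Real.mul_self_sqrt (show 0 ≤ t * √m / K by positivity)
    have h := nuclearNorm_le (√(t * √m / K) • S) ((√(t * √m / K) / √m) • (S * labels n))
    rw [frobSq_smul, frobSq_smul, hfS, hfSY, transpose_smul, simplexMatrix_transpose,
      Matrix.smul_mul, Matrix.mul_smul, smul_smul, ← Matrix.mul_assoc, simplexMatrix_mul_self,
      Matrix.smul_mul, smul_smul, div_pow, sq, hc, sq, hsq] at h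
    have e1 : √(t * √m / K) * (√(t * √m / K) / √m) * K = t := by
      rw [← mul_div_assoc, hc]
      field_simp
    rw [e1] at h
    refine h.trans_eq ?_
    field_simp
    ring
  · obtain ⟨W, H, hA, hN⟩ := exists_factorization (t • (S * labels n))
    have h := trace_le_of_partialIsometry (U := (1 / (K : ℝ)) • S)
      (V := (1 / (K * √m)) • (S * labels n)ᵀ) ?_ ?_ W H
    · rw [hN, hA, transpose_smul, simplexMatrix_transpose] at h
      simp only [Matrix.smul_mul, Matrix.mul_smul, smul_smul, trace_smul] at h
      rw [Matrix.mul_assoc, hSYS, Matrix.mul_smul, simplexMatrix_mul_self] at h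
      simp only [smul_smul, trace_smul, trace_simplexMatrix, smul_eq_mul] at h
      refine le_of_eq_of_le ?_ h
      field_simp
      linear_combination (t * (K - 1)) * hsq
    · rw [transpose_smul, simplexMatrix_transpose]
      simp only [Matrix.smul_mul, Matrix.mul_smul, smul_smul]
      rw [simplexMatrix_mul_self, Matrix.smul_mul, simplexMatrix_mul_self, smul_smul, smul_smul]
      congr 1
      field_simp
    · rw [transpose_smul, transpose_transpose]
      simp only [Matrix.smul_mul, Matrix.mul_smul, smul_smul]
      rw [Matrix.mul_assoc, hSYS, Matrix.mul_smul, smul_smul, transpose_mul,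
        simplexMatrix_transpose, Matrix.mul_assoc, simplexMatrix_mul_self, Matrix.mul_smul,
        smul_smul]
      congr 1
      field_simp
      rw [sq, hsq]

theorem nuclearNorm_simplex (hK : 0 < K) {m : ℕ} (hm0 : 0 < m)
    (hm : ∀ k, n k = m) (t : ℝ) :
    nuclearNorm (t • (simplexMatrix K * labels n)) = |t| * K * (K - 1) * √m := by
  rcases le_total 0 t with ht | ht
  · rw [abs_of_nonneg ht, nuclearNorm_simplex_of_nonneg hK hm0 hm ht]
  · rw [abs_of_nonpos ht, ← nuclearNorm_neg, ← neg_smul,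
      nuclearNorm_simplex_of_nonneg hK hm0 hm (neg_nonneg.2 ht)]

theorem avgLoss_simplex (hK : 0 < K) (hn : ∀ k, 0 < n k) (t : ℝ) :
    avgLoss n (t • (simplexMatrix K * labels n)) 0 =
      Real.log (Real.exp (t * K) + (K - 1)) - t * K := by
  have hce : ∀ s : Sample n, crossEntropy
      (fun l => (t • (simplexMatrix K * labels n)) l s + (0 : Fin K → ℝ) l) s.1 =
      Real.log (Real.exp (t * K) + (K - 1)) - t * K := fun s => by
    have h := crossEntropy_add_const (fun l => if l = s.1 then t * K else 0) (-t) s.1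
    have e : (fun l => (t • (simplexMatrix K * labels n)) l s + (0 : Fin K → ℝ) l) =
        fun l => (if l = s.1 then t * K else 0) + -t := by
      ext l
      rw [Matrix.smul_apply, mul_labels_apply, simplexMatrix_apply]
      simp only [Pi.zero_apply, smul_eq_mul]
      split_ifs <;> ring
    rw [e, h, crossEntropy]
    have hsum : ∑ l, Real.exp (if l = s.1 then t * K else 0) = Real.exp (t * K) + (K - 1) := by
      have : ∀ l, Real.exp (if l = s.1 then t * (K : ℝ) else 0) =
          (if l = s.1 then Real.exp (t * K) - 1 else 0) + 1 := fun l => by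
        split_ifs <;> simp
      simp only [this, Finset.sum_add_distrib, Finset.sum_ite_eq', Finset.mem_univ, if_true,
        Finset.sum_const, Finset.card_univ, Fintype.card_fin, nsmul_eq_mul, mul_one]
      ring
    rw [hsum, if_pos rfl]
  rw [avgLoss_eq, Finset.sum_congr rfl fun s _ => hce s, Finset.sum_const, Finset.card_univ,
    Fintype.card_sigma, nsmul_eq_mul]
  simp only [Fintype.card_fin, Nat.cast_sum]
  have := total_pos hK hn
  rw [← mul_assoc, show (∑ k, (n k : ℝ)) = total n from rfl, one_div, inv_mul_cancel₀ this.ne',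
    one_mul]

theorem eq_zero_of_isMinOn_of_const (hK : 0 < K) (hlamb : 0 < lamb)
    (h : IsMinOn (convexObjective n lamZ lamb) Set.univ (Z, b)) (hb : ∀ k l, b k = b l) :
    b = 0 := by
  have hmin := h (Set.mem_univ (Z, 0))
  have hloss : avgLoss n Z b = avgLoss n Z 0 :=
    avgLoss_shift _ _ _ _ (fun _ => b ⟨0, hK⟩) fun l s => by simp [hb l ⟨0, hK⟩]
  simp only [Set.mem_ofPred_eq, convexObjective, hloss] at hmin
  have hsum : ∑ k, b k ^ 2 ≤ 0 :=
    le_of_mul_le_mul_left (a := lamb / 2) (by simpa using hmin) (by positivity)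
  have h0 := le_antisymm hsum (Finset.sum_nonneg fun k _ => sq_nonneg (b k))
  ext k
  have := (Finset.sum_eq_zero_iff_of_nonneg fun k _ => sq_nonneg (b k)).1 h0 k (Finset.mem_univ _)
  exact pow_eq_zero_iff two_ne_zero |>.1 this

theorem exists_eq_smul_simplexMatrix (hK : 1 < K) {M : Matrix (Fin K) (Fin K) ℝ}
    (hM : ClusterInvariant n M) (hn : ∀ k l, n k = n l) (hsum : ∀ k, ∑ l, M l k = 0) :
    ∃ a : ℝ, M = a • simplexMatrix K := by
  set k₀ : Fin K := ⟨0, by omega⟩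
  set k₁ : Fin K := ⟨1, hK⟩
  have h01 : k₀ ≠ k₁ := by simp [k₀, k₁]
  have hoff : ∀ k l, k ≠ l → M k l = M k₀ k₁ := fun k l hkl =>
    hM.offDiag_eq (hn _ _) (hn _ _) hkl h01
  refine ⟨-M k₀ k₁, ?_⟩
  ext k l
  rw [Matrix.smul_apply, simplexMatrix_apply, smul_eq_mul]
  split_ifs with h
  · subst h
    have h1 := hsum k
    rw [← Finset.add_sum_erase _ _ (Finset.mem_univ k), Finset.sum_congr rfl fun l hl =>
      hoff l k (Finset.ne_of_mem_erase hl), Finset.sum_const, Finset.card_erase_of_mem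
      (Finset.mem_univ k), Finset.card_univ, Fintype.card_fin, nsmul_eq_mul,
      Nat.cast_sub hK.le] at h1
    push_cast at h1
    linarith
  · rw [hoff k l h]
    ring

/-- On the line of multiples t(KI - J)Y with b = 0, the substitution x = tK gives the scalar problem
with κ = K - 1 and q = λ_Z√m. -/
theorem balanced_coefficient (hK : 1 < K) (hn : ∀ k, 0 < n k) (hlamZ : 0 < lamZ) {m : ℕ}
    (hm : ∀ k, n k = m) {a : ℝ}
    (h : IsMinOn (convexObjective n lamZ lamb) Set.univ (a • (simplexMatrix K * labels n), 0)) :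
    (Real.sqrt (total n / K) ≤ total n * lamZ → a = 0) ∧
      (total n * lamZ < Real.sqrt (total n / K) →
        a = 1 / K * Real.log (Real.sqrt K / (Real.sqrt (total n) * lamZ) - K + 1)) := by
  have hK0 : 0 < K := by omega
  have hm0 : 0 < m := hm ⟨0, hK0⟩ ▸ hn ⟨0, hK0⟩
  have hK' : (0 : ℝ) < K := Nat.cast_pos.2 hK0
  have hκ : (0 : ℝ) < K - 1 := by
    have : (1 : ℝ) < K := by exact_mod_cast hK
    linarith
  have hm' : (0 : ℝ) < m := Nat.cast_pos.2 hm0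
  have hsq := Real.mul_self_sqrt hm'.le
  have hs0 := Real.sqrt_pos.2 hm'
  have hKs0 := Real.sqrt_pos.2 hK'
  have htot : total n = K * m := by simp [total, hm]
  have hdiv : total n / K = m := by
    rw [htot]
    field_simp
  have hkey := scalar_minimizer (κ := K - 1) (q := lamZ * √m) (x := a * K) hκ (by positivity)
    fun y => by
      have hmin := h (Set.mem_univ ((y / K) • (simplexMatrix K * labels n), 0))
      simp only [Set.mem_ofPred_eq, convexObjective, avgLoss_simplex hK0 hn,
        nuclearNorm_simplex hK0 hm0 hm, div_mul_cancel₀ y hK'.ne', abs_div, abs_of_pos hK'] at hmin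
      rw [div_mul_cancel₀ _ hK'.ne'] at hmin
      rw [abs_mul, abs_of_pos hK']
      linarith
  have hcond : (K : ℝ) * m * lamZ = √m * (lamZ * √m * (K - 1 + 1)) := by
    linear_combination (-(K * lamZ) : ℝ) * hsq
  rw [hdiv]
  refine ⟨fun hle => ?_, fun hlt => ?_⟩
  · have := hkey.1 (by
      rw [htot, hcond] at hle
      exact (le_mul_iff_one_le_right hs0).1 hle)
    exact (mul_eq_zero.1 this).resolve_right hK'.ne'
  · have := hkey.2 (by
      rw [htot, hcond] at hlt
      exact (mul_lt_iff_lt_one_right hs0).1 hlt)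
    have e : √(K : ℝ) / (√(total n) * lamZ) - K + 1 = 1 / (lamZ * √m) - (K - 1) := by
      rw [htot, Real.sqrt_mul hK'.le]
      field_simp
      ring
    rw [e, ← this]
    field_simp

end Balanced

/-! ### Gram matrices of the weights and features. -/

section Features

variable {K : ℕ} {n : Fin K → ℕ}

theorem diagonal_sqrt_mul_inv (hn : ∀ k, 0 < n k) :
    (diagonal fun k => √(n k : ℝ)) * (diagonal fun k => (√(n k : ℝ))⁻¹) = 1 := by
  rw [diagonal_mul_diagonal, ← diagonal_one]
  congr 1
  ext k
  exact mul_inv_cancel₀ (Real.sqrt_pos.2 (Nat.cast_pos.2 (hn k))).ne'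

theorem posSemidef_transpose_mul_self {ι κ : Type*} [Fintype ι] [Fintype κ] (A : Matrix ι κ ℝ) :
    (Aᵀ * A).PosSemidef := by
  simpa only [conjTranspose_eq_transpose_of_trivial] using posSemidef_conjTranspose_mul_self A

/-- The positive square root of `(U Σ Vᵀ) (U Σ Vᵀ)ᵀ` is `U Σ Uᵀ`. -/
theorem clusterInvariant_gram_of_svd {U V : Matrix (Fin K) (Fin K) ℝ} {σ : Fin K → ℝ}
    (hσ : ∀ k, 0 ≤ σ k) (hU : Uᵀ * U = 1) (hV : Vᵀ * V = 1)
    (hM : ClusterInvariant n (U * diagonal σ * Vᵀ)) :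
    ClusterInvariant n
      (((diagonal fun k => √(σ k)) * Uᵀ)ᵀ * ((diagonal fun k => √(σ k)) * Uᵀ)) := by
  refine ClusterInvariant.of_mul_self (posSemidef_transpose_mul_self _) ?_
  convert hM.mul hM.transpose using 1
  have hG : ((diagonal fun k => √(σ k)) * Uᵀ)ᵀ * ((diagonal fun k => √(σ k)) * Uᵀ) =
      U * diagonal σ * Uᵀ := by
    rw [transpose_mul, transpose_transpose, diagonal_transpose, Matrix.mul_assoc,
      ← Matrix.mul_assoc (diagonal _), diagonal_sqrt_mul_self hσ, ← Matrix.mul_assoc]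
  rw [hG, transpose_mul, transpose_mul, transpose_transpose, diagonal_transpose]
  simp only [Matrix.mul_assoc]
  rw [← Matrix.mul_assoc Uᵀ, hU, ← Matrix.mul_assoc Vᵀ, hV]

end Features

end UFM

open Matrix UFM in
theorem mainTheorem1 {K : ℕ} (hK : 0 < K) (n : Fin K → ℕ) (hn : ∀ k, 0 < n k)
    (lamZ lamb : ℝ) (hlamZ : 0 < lamZ) (hlamb : 0 < lamb) :
    -- existence and uniqueness of the global minimizer
    (∃! p : Matrix (Fin K) (Sample n) ℝ × (Fin K → ℝ),
      IsMinOn (convexObjective n lamZ lamb) Set.univ p) ∧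
    ∀ (Z : Matrix (Fin K) (Sample n) ℝ) (b : Fin K → ℝ),
      IsMinOn (convexObjective n lamZ lamb) Set.univ (Z, b) →
      -- (a) within-class collapse
      ((∀ k (i : Fin (n k)) l, Z l ⟨k, i⟩ = classMean n Z l k) ∧
        (∀ k, ∑ l, classMean n Z l k = 0) ∧
        Z = classMean n Z * labels n) ∧
      -- (b) block structure over the clusters
      ((∀ (J : ℕ) (Ns : Fin J → ℕ), Function.Injective Ns → Set.range Ns = Set.range n →
          ∃ (a : Fin J → ℝ) (A : Fin J → Fin J → ℝ) (c : Fin J → ℝ),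
            classMean n Z = blockMatrix n Ns a A ∧
            b = ∑ j, c j • indVec (cluster n (Ns j)) ∧
            ∀ j, a j + ∑ j', A j' j * ((cluster n (Ns j')).card : ℝ) = 0) ∧
        EqualAngles n (classMean n Z)) ∧
      -- (c) the balanced case
      ((∀ k l, n k = n l) →
        b = 0 ∧
        ∃ a : ℝ,
          classMean n Z = a • ((K : ℝ) • (1 : Matrix (Fin K) (Fin K) ℝ) - Matrix.of fun _ _ => 1) ∧
          (Real.sqrt (total n / K) ≤ total n * lamZ → a = 0) ∧
          (total n * lamZ < Real.sqrt (total n / K) →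
            a = 1 / K * Real.log (Real.sqrt K / (Real.sqrt (total n) * lamZ) - K + 1))) ∧
      -- (d) weights and features from any singular value decomposition `U Σ Vᵀ` of `Z̄ D^{1/2}`
      (∀ U ∈ Matrix.orthogonalGroup (Fin K) ℝ, ∀ V ∈ Matrix.orthogonalGroup (Fin K) ℝ,
        ∀ σ : Fin K → ℝ, (∀ k, 0 ≤ σ k) →
        classMean n Z * Matrix.diagonal (fun k => Real.sqrt (n k)) =
          U * Matrix.diagonal σ * Vᵀ →
        ∀ W Hbar : Matrix (Fin K) (Fin K) ℝ,
        W = Matrix.diagonal (fun k => Real.sqrt (σ k)) * Uᵀ →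
        Hbar = Matrix.diagonal (fun k => Real.sqrt (σ k)) * Vᵀ *
          Matrix.diagonal (fun k => (Real.sqrt (n k))⁻¹) →
        classMean n Z = Wᵀ * Hbar ∧
        Z = Wᵀ * (Hbar * labels n) ∧
        -- block structure of the Gram matrices, and equal angles of the mean features
        (∀ (J : ℕ) (Ns : Fin J → ℕ), Function.Injective Ns → Set.range Ns = Set.range n →
          (∃ (a : Fin J → ℝ) (A : Fin J → Fin J → ℝ), Wᵀ * W = blockMatrix n Ns a A) ∧
          (∃ (a : Fin J → ℝ) (A : Fin J → Fin J → ℝ), Hbarᵀ * Hbar = blockMatrix n Ns a A)) ∧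
        EqualAngles n Hbar ∧
        -- up to the scaling between `lamW` and `lamH` and an isometry of the feature space, these
        -- are exactly the global minimizers of the factorized model
        ∀ lamW lamH : ℝ, 0 < lamW → 0 < lamH → Real.sqrt (lamW * lamH) = lamZ →
          ∀ d : ℕ, K ≤ d →
          ∀ (W' : Matrix (Fin d) (Fin K) ℝ) (H' : Matrix (Fin d) (Sample n) ℝ) (b' : Fin K → ℝ),
            IsMinOn (factorizedObjective n lamW lamH lamb d) Set.univ (W', H', b') ↔
              b' = b ∧ ∃ Q : Matrix (Fin d) (Fin K) ℝ, Qᵀ * Q = 1 ∧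
                W' = (lamH / lamW) ^ (1 / 4 : ℝ) • (Q * W) ∧
                H' = (lamW / lamH) ^ (1 / 4 : ℝ) • (Q * (Hbar * labels n))) := by
  refine ⟨?_, fun Z b h => ?_⟩
  · obtain ⟨⟨Z, b⟩, h⟩ := exists_isMinOn (n := n) hlamZ hlamb
    refine ⟨(Z, b), h, fun ⟨Z', b'⟩ h' => ?_⟩
    obtain ⟨rfl, rfl⟩ := eq_of_isMinOn hK hn hlamZ hlamb h' h
    rfl
  have hcol := eq_classMean_of_isMinOn hK hn hlamZ hlamb h
  have hsum : ∀ k, ∑ l, classMean n Z l k = 0 := fun k => by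
    rw [← sum_eq_zero_of_isMinOn hK hlamZ h ⟨k, ⟨0, hn k⟩⟩]
    exact Finset.sum_congr rfl fun l _ => (hcol k _ l).symm
  have hZY : Z = classMean n Z * labels n := by
    ext l s
    rw [mul_labels_apply]
    exact hcol s.1 s.2 l
  obtain ⟨hinv, hbinv⟩ := clusterInvariant_classMean hK hn hlamZ hlamb h
  have hb : ∀ k l, n k = n l → b k = b l := fun k l hkl => by
    have := hbinv (Equiv.swap k l) (swap_preserves hkl) k
    rwa [Equiv.swap_apply_left, eq_comm] at this
  refine ⟨⟨hcol, hsum, hZY⟩, ⟨fun J Ns hNs hr => ?_,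
    equalAngles_of_clusterInvariant (hinv.transpose.mul hinv)⟩, fun hbal => ?_, ?_⟩
  · obtain ⟨a, A, hA⟩ := hinv.exists_blockMatrix hNs hr
    obtain ⟨c, hc⟩ := exists_sum_smul_indVec hb hNs hr
    refine ⟨a, A, c, hA, hc, fun i => ?_⟩
    have hj' : ∀ k, ∃ i, Ns i = n k := fun k => by
      have : n k ∈ Set.range Ns := hr ▸ Set.mem_range_self k
      exact this
    choose j hj using hj'
    obtain ⟨k, hk⟩ : Ns i ∈ Set.range n := hr ▸ Set.mem_range_self i
    have hjk : j k = i := hNs (by rw [hj, hk])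
    have := sum_blockMatrix hNs hj a A k
    rw [← hA, hsum, hjk] at this
    exact this.symm
  · have hb0 : b = 0 := eq_zero_of_isMinOn_of_const hK hlamb h fun k l => hb k l (hbal k l)
    refine ⟨hb0, ?_⟩
    rcases Nat.lt_or_ge 1 K with hK1 | hK1
    · obtain ⟨a, ha⟩ := exists_eq_smul_simplexMatrix hK1 hinv hbal hsum
      refine ⟨a, ha, balanced_coefficient (lamb := lamb) hK1 hn hlamZ (fun k => hbal k ⟨0, hK⟩) ?_⟩
      rw [← Matrix.smul_mul, ← ha, ← hZY, ← hb0]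
      exact h
    -- Now KI - J = 0 and Z̄ = 0, so any a is admissible and is chosen to fit whichever condition
    -- holds.
    · obtain rfl : K = 1 := by omega
      have h0 : ∀ a : ℝ, classMean n Z =
          a • (((1 : ℕ) : ℝ) • (1 : Matrix (Fin 1) (Fin 1) ℝ) - Matrix.of fun _ _ => 1) := by
        intro a
        ext k l
        have := hsum l
        rw [Fin.sum_univ_one] at this
        rw [Subsingleton.elim k 0, this]
        simp [Subsingleton.elim l 0]
      rcases le_or_gt (Real.sqrt (total n / (1 : ℕ))) (total n * lamZ) with hle | hlt
      · exact ⟨0, h0 0, fun _ => rfl, fun hlt => absurd hle (not_le.2 hlt)⟩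
      · exact ⟨_, h0 _, fun hle => absurd hle (not_le.2 hlt), fun _ => rfl⟩
  · intro U hU V hV σ hσ hsvd W Hbar hW hHbar
    have hUU : Uᵀ * U = 1 := (mem_orthogonalGroup_iff' _ _).1 hU
    have hVV : Vᵀ * V = 1 := (mem_orthogonalGroup_iff' _ _).1 hV
    have hmean : classMean n Z = U * diagonal σ * Vᵀ * diagonal (fun k => (√(n k : ℝ))⁻¹) := by
      rw [← hsvd, Matrix.mul_assoc, diagonal_sqrt_mul_inv hn, Matrix.mul_one]
    have hMinv : ClusterInvariant n (U * diagonal σ * Vᵀ) :=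
      hsvd ▸ hinv.mul (clusterInvariant_diagonal fun m => √(m : ℝ))
    have hWH : classMean n Z = Wᵀ * Hbar := by
      rw [hmean, hW, hHbar, transpose_mul, transpose_transpose, diagonal_transpose,
        ← diagonal_sqrt_mul_self hσ]
      simp only [Matrix.mul_assoc]
    have hgW : ClusterInvariant n (Wᵀ * W) := by
      rw [hW]
      exact clusterInvariant_gram_of_svd hσ hUU hVV hMinv
    have hgH : ClusterInvariant n (Hbarᵀ * Hbar) := by
      -- Transposing exchanges U and V, so the argument for WᵀW applies to H̄ up to the diagonal
      -- factors D^{-1/2}.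
      have hMt : ClusterInvariant n (V * diagonal σ * Uᵀ) := by
        have := hMinv.transpose
        rwa [transpose_mul, transpose_mul, transpose_transpose, diagonal_transpose,
          ← Matrix.mul_assoc] at this
      have hD := clusterInvariant_diagonal (n := n) fun m => (√(m : ℝ))⁻¹
      have := (hD.mul (clusterInvariant_gram_of_svd hσ hVV hUU hMt)).mul hD
      rw [hHbar, transpose_mul _ (diagonal _), diagonal_transpose]
      simpa only [Matrix.mul_assoc] using this
    refine ⟨hWH, by rw [← Matrix.mul_assoc, ← hWH]; exact hZY, fun J Ns hNs hr =>
      ⟨hgW.exists_blockMatrix hNs hr, hgH.exists_blockMatrix hNs hr⟩,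
      equalAngles_of_clusterInvariant hgH, ?_⟩
    intro lamW lamH hlW hlH hlam d hd W' H' b'
    have hHY : Hbar * labels n = (diagonal fun k => √(σ k)) *
        ((labels n)ᵀ * (diagonal (fun k => (√(n k : ℝ))⁻¹) * V))ᵀ := by
      rw [hHbar, transpose_mul, transpose_mul, transpose_transpose, diagonal_transpose]
      simp only [Matrix.mul_assoc]
    have hZsvd : Z = U * diagonal σ *
        ((labels n)ᵀ * (diagonal (fun k => (√(n k : ℝ))⁻¹) * V))ᵀ := by
      rw [transpose_mul, transpose_mul, transpose_transpose, diagonal_transpose]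
      conv_lhs => rw [hZY, hmean]
      simp only [Matrix.mul_assoc]
    rw [hHY, hW]
    exact isMinOn_factorizedObjective_iff hK hn hlamZ hlamb h hUU (isometry_labels hn hVV) hσ hZsvd
      hlW hlH hlam hd W' H' b'
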